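/- Let $\mathcal T$ be the set of (finite or infinite) rooted planar trees in which every vertex has finitely many offspring and the root has exactly one; two trees are identified if there is an isomorphism between them preserving the root and the left-to-right order. For $T\in\mathcal T$ let $D_r(T)$ be the set of vertices at distance $r$ from the root, $|T|$ the number of edges, $h(T)=\sup\{r : D_r(T)\neq\emptyset\}$ the height, and $B_r(T)$ the subtree spanned by the vertices at distance at most $r$ from the root. Equip $\mathcal T$ with the metric $\mathrm{dist}(T,T')=\inf\{1/r : r\in\{1,2,\dots\},\ B_r(T)=B_r(T')\}$ and its Borel $\sigma$-algebra, and let $\mathcal B_a(T_0)=\{T\in\mathcal T : \mathrm{dist}(T,T_0)\le a\}$. Let $A_{m,N}$ be the number of trees of height at most $m$ and size $|T|=N$. For $\mu\in\mathbb R$ and $N\ge 1$ let $\nu_N^{(\mu)}$ be the probability measure on $\mathcal T$ supported on the trees of size $N$ with $$\nu_N^{(\mu)}(\{T\})=\frac{e^{-\mu h(T)}}{Z_N^{(\mu)}}\quad (|T|=N),\qquad Z_N^{(\mu)}=\sum_{m=1}^\infty e^{-\mu m}(A_{m,N}-A_{m-1,N}).$$ Let $X(g)=\sum_{T\ \mathrm{finite}}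 g^{|T|}$ and $g_c(k)=k/(1+k)^2$. **Theorem.** Let $\mu<0$ and $k=e^{-\mu}$. The series defining $X(g_c(k))$ converges, and the sequence $(\nu_N^{(\mu)})_{N\ge1}$ converges weakly to a Borel probability measure $\nu^{(\mu)}$ on $\mathcal T$. This measure satisfies $$\nu^{(\mu)}\big(\mathcal B_{1/r}(T_0)\big)=K\,k^{\,r-1}\,g_c(k)^{|T_0|-K}\,X(g_c(k))^{K-1},\qquad K=|D_r(T_0)|,$$ for every finite tree $T_0\in\mathcal T$ of height $r$, and it is the only Borel probability measure on $\mathcal T$ with this property. -/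

import Mathlib

open MeasureTheory Filter Topology

/-- Rooted planar trees, finite or infinite, every vertex having finitely many offspring, and the
root having exactly one, encoded by words of natural numbers. The root `i₀` is the empty word, the
offspring of a vertex `v` are, from left to right, `v ++ [0]`, `v ++ [1]`, …, `v ++ [n - 1]`, and
the parent of `v ++ [i]` is `v`. Every isomorphism class of rooted planar trees (with finite, totally
ordered generations, order-preserving parent maps and a single root edge) has exactly one such
code, so equality of codes is equality of planar trees. -/
@[ext]
structure PlaneTree where
  /-- the vertices of the tree -/
  verts : Set (List ℕ)
  root_mem : [] ∈ verts
  parent_mem : ∀ (v : List ℕ) (i : ℕ), v ++ [i] ∈ verts → v ∈ verts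
  offspring : ∀ v ∈ verts, ∃ n : ℕ, ∀ i : ℕ, v ++ [i] ∈ verts ↔ i < n
  root_edge : ∀ i : ℕ, [i] ∈ verts ↔ i = 0

namespace PlaneTree

/-- `D_r(T)`, the set of vertices of `T` at distance `r` from the root. -/
def level (T : PlaneTree) (r : ℕ) : Set (List ℕ) := {v ∈ T.verts | v.length = r}

/-- `E(T)`, the set of edges: each vertex other than the root is joined to its parent. -/
def edges (T : PlaneTree) : Set (Sym2 (List ℕ)) :=
  {e | ∃ (v : List ℕ) (i : ℕ), v ++ [i] ∈ T.verts ∧ e = s(v ++ [i], v)}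

/-- The size `|T|`, the number of edges; it is `⊤` exactly for infinite trees. -/
noncomputable def size (T : PlaneTree) : ℕ∞ := T.edges.encard

/-- The height `h(T)`, the supremum of all `r` with `D_r(T) ≠ ∅`. -/
noncomputable def height (T : PlaneTree) : ℕ∞ :=
  ⨆ (r : ℕ) (_ : (T.level r).Nonempty), (r : ℕ∞)

/-- `B_r(T)`, the ball of radius `r` around the root of `T`, given by its set of vertices
(with the above encoding the subtree is determined by this set). -/
def rootBall (T : PlaneTree) (r : ℕ) : Set (List ℕ) := {v ∈ T.verts | v.length ≤ r}

/-- The set of all `1 / r`, `r ≥ 1`, such that `B_r(T) = B_r(T')`. -/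
def agreeRadii (T T' : PlaneTree) : Set ℝ :=
  {a | ∃ r : ℕ, 1 ≤ r ∧ T.rootBall r = T'.rootBall r ∧ a = 1 / (r : ℝ)}

noncomputable instance : Dist PlaneTree := ⟨fun T T' => sInf (agreeRadii T T')⟩

theorem dist_def (T T' : PlaneTree) : dist T T' = sInf (agreeRadii T T') := rfl

theorem rootBall_one (T : PlaneTree) : T.rootBall 1 = {[], [0]} := by
  ext v
  rcases v with _ | ⟨i, _ | ⟨j, l⟩⟩
  · simp [rootBall, T.root_mem]
  · simp [rootBall, T.root_edge]
  · simp [rootBall]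

theorem rootBall_mono {T T' : PlaneTree} {r s : ℕ} (h : T.rootBall s = T'.rootBall s)
    (hrs : r ≤ s) : T.rootBall r = T'.rootBall r := by
  ext v
  have hv := Set.ext_iff.1 h v
  simp only [rootBall, Set.mem_ofPred_eq] at hv ⊢
  constructor
  · rintro ⟨h1, h2⟩
    exact ⟨(hv.1 ⟨h1, h2.trans hrs⟩).1, h2⟩
  · rintro ⟨h1, h2⟩
    exact ⟨(hv.2 ⟨h1, h2.trans hrs⟩).1, h2⟩

theorem agreeRadii_nonempty (T T' : PlaneTree) : (agreeRadii T T').Nonempty :=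
  ⟨1, 1, le_rfl, by rw [rootBall_one, rootBall_one], by simp⟩

theorem agreeRadii_nonneg {T T' : PlaneTree} {a : ℝ} (ha : a ∈ agreeRadii T T') : 0 ≤ a := by
  obtain ⟨r, _, _, rfl⟩ := ha
  positivity

theorem dist_le_of_mem {T T' : PlaneTree} {a : ℝ} (ha : a ∈ agreeRadii T T') : dist T T' ≤ a :=
  csInf_le ⟨0, fun _ h => agreeRadii_nonneg h⟩ ha

theorem dist_le_add {T T' T'' : PlaneTree} {a b : ℝ} (ha : a ∈ agreeRadii T T')
    (hb : b ∈ agreeRadii T' T'') : dist T T'' ≤ a + b := by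
  have ha0 := agreeRadii_nonneg ha
  have hb0 := agreeRadii_nonneg hb
  obtain ⟨r, hr, h1, rfl⟩ := ha
  obtain ⟨s, hs, h2, rfl⟩ := hb
  rcases le_total r s with h | h
  · refine (dist_le_of_mem ⟨r, hr, h1.trans (rootBall_mono h2 h), rfl⟩).trans ?_
    linarith
  · refine (dist_le_of_mem ⟨s, hs, (rootBall_mono h1 h).trans h2, rfl⟩).trans ?_
    linarith

/-- The metric `dist(T, T') = inf {1 / r | r ≥ 1, B_r(T) = B_r(T')}`. -/
noncomputable instance : MetricSpace PlaneTree where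
  dist_self T := by
    refine le_antisymm (le_of_forall_pos_le_add fun ε hε => ?_)
      (le_csInf (agreeRadii_nonempty T T) fun _ h => agreeRadii_nonneg h)
    obtain ⟨n, hn⟩ := exists_nat_one_div_lt hε
    have h : 1 / ((n + 1 : ℕ) : ℝ) ∈ agreeRadii T T := ⟨n + 1, by omega, rfl, rfl⟩
    have := dist_le_of_mem h
    push_cast at this
    linarith
  dist_comm T T' := by
    have : agreeRadii T T' = agreeRadii T' T := by
      ext a
      simp only [agreeRadii, Set.mem_ofPred_eq, eq_comm]
    rw [dist_def, dist_def, this]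
  dist_triangle T T' T'' := by
    have h1 : dist T T'' - dist T T' ≤ dist T' T'' := by
      refine le_csInf (agreeRadii_nonempty T' T'') fun b hb => ?_
      have h2 : dist T T'' - b ≤ dist T T' := by
        refine le_csInf (agreeRadii_nonempty T T') fun a ha => ?_
        have := dist_le_add ha hb
        linarith
      linarith
    linarith
  eq_of_dist_eq_zero {T T'} h := by
    ext v
    have hpos : (0 : ℝ) < 1 / ((v.length + 1 : ℕ) : ℝ) := by positivity
    rw [dist_def] at h
    obtain ⟨a, ⟨r, hr, hb, rfl⟩, hlt⟩ :=
      exists_lt_of_csInf_lt (agreeRadii_nonempty T T') (h.trans_lt hpos)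
    have hr0 : (0 : ℝ) < r := by exact_mod_cast hr
    have hlt' : v.length + 1 < r := by
      exact_mod_cast lt_of_one_div_lt_one_div hr0 hlt
    have hv := Set.ext_iff.1 hb v
    simp only [rootBall, Set.mem_ofPred_eq] at hv
    have hle : v.length ≤ r := by omega
    simpa [hle] using hv

noncomputable instance : MeasurableSpace PlaneTree := borel PlaneTree

instance : BorelSpace PlaneTree := ⟨rfl⟩

/-- `A_{m,N}`, the number of trees of height at most `m` and size `N`. -/
noncomputable def countTrees (m N : ℕ) : ℕ :=
  {T : PlaneTree | T.height ≤ m ∧ T.size = N}.ncard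

/-- `Z_N^{(μ)} = ∑_{m ≥ 1} e^{-μ m} (A_{m,N} - A_{m-1,N})`. -/
noncomputable def partitionFunction (μ : ℝ) (N : ℕ) : ℝ :=
  ∑' m : ℕ, Real.exp (-μ * (m + 1)) * ((countTrees (m + 1) N : ℝ) - countTrees m N)

/-- `ν_N^{(μ)}`, the measure on the space of all trees that gives mass
`e^{-μ h(T)} / Z_N^{(μ)}` to each tree `T` of size `N`. -/
noncomputable def finiteSizeMeasure (μ : ℝ) (N : ℕ) : Measure PlaneTree :=
  Measure.sum fun T : {T : PlaneTree // T.size = N} =>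
    ENNReal.ofReal (Real.exp (-μ * (T.1.height.toNat : ℝ)) / partitionFunction μ N) •
      Measure.dirac T.1

/-- `X(g) = ∑ g^{|T|}`, the sum over all finite trees `T`. -/
noncomputable def genFun (g : ℝ) : ℝ :=
  ∑' T : {T : PlaneTree // T.size ≠ ⊤}, g ^ T.1.size.toNat

/-- `g_c(k) = k / (1 + k)^2`. -/
noncomputable def criticalPoint (k : ℝ) : ℝ := k / (1 + k) ^ 2

end PlaneTree

/-!
Cutting a tree at height `s + 1` leaves a finite tree whose topmost vertices carry independent
subtrees. Hence, with `X_m` the generating series by size of the trees of height at most `m`, the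
trees in a cylinder of radius `s + 1` whose boundary has `K` vertices, weighted by `k ^ height`, are
counted up to a monomial by `F_K = ∑ k ^ (m + 1) (X_{m + 1} ^ K - X_m ^ K)`; and
`(1 - X_m) X_{m + 1} = x` gives the values of all `X_m` at `g = g_c(k)` explicitly. They approach
`X(g) = 1 / (1 + k)` geometrically with ratio `1 / k`, exactly compensating the weights, so that
`F_1` has a simple pole at `g`, while `F_{K + 1} - X F_K - X ^ K F_1` stays finite there. Thus `F_K`
has a simple pole with residue proportional to `K X(g) ^ (K - 1)`.

Multiplication by `g - x` turns the coefficients of a series with a simple pole at `g` into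
convergent ones, so the finite-size probability of each cylinder converges to an explicit limit. The
same argument bounds it uniformly in the size by a summable function of the cylinder, which yields
tightness. By Prokhorov's theorem the measures converge, and uniqueness holds because the cylinders
around trees that reach the radius form a π-system generating the Borel sets.
-/

section PowerSeriesValues

open PowerSeries
open Finset.HasAntidiagonal (antidiagonal mem_antidiagonal)
open scoped PowerSeries.WithPiTopology

/-- The real power series with nonnegative coefficients. The coefficientwise order `F ≤ G` is
written `G - F ∈ nonnegCoeffs`. -/
def nonnegCoeffs : Subsemiring ℝ⟦X⟧ where
  carrier := {F | ∀ n, 0 ≤ coeff n F}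
  mul_mem' hF hG n := by
    rw [coeff_mul]
    exact Finset.sum_nonneg fun p _ => mul_nonneg (hF p.1) (hG p.2)
  one_mem' n := by
    rw [coeff_one]
    split_ifs <;> norm_num
  add_mem' hF hG n := by
    rw [map_add]
    exact add_nonneg (hF n) (hG n)
  zero_mem' n := by rw [map_zero]

/-- The series `F` converges at `x` with value `a`. Convergence at a real point is automatically
absolute in the sense of `HasSum`. -/
def HasValueAt (F : ℝ⟦X⟧) (x a : ℝ) : Prop := HasSum (fun n => coeff n F * x ^ n) a

/-- `(x - X) F` converges at `x` with value `b`: if `F` is meromorphic near `x` this says that `F`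
has at most a simple pole there, with residue `-b`. -/
def HasResidueAt (F : ℝ⟦X⟧) (x b : ℝ) : Prop := HasValueAt ((C x - X) * F) x b

variable {F G H : ℝ⟦X⟧} {x a b c : ℝ}

theorem C_mem_nonnegCoeffs (hc : 0 ≤ c) : C c ∈ nonnegCoeffs := fun n => by
  rw [coeff_C]
  split_ifs <;> [exact hc; exact le_rfl]

theorem X_mem_nonnegCoeffs : X ∈ nonnegCoeffs := fun n => by
  rw [coeff_X]
  split_ifs <;> norm_num

theorem mem_nonnegCoeffs_of_hasSum {ι : Type*} {Q : ι → ℝ⟦X⟧} (hQ : ∀ i, Q i ∈ nonnegCoeffs)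
    (hF : HasSum Q F) : F ∈ nonnegCoeffs := fun n =>
  ((WithPiTopology.hasSum_iff_hasSum_coeff ℝ).1 hF n).nonneg fun i => hQ i n

theorem pow_sub_pow_mem_nonnegCoeffs (hF : F ∈ nonnegCoeffs) (hG : G ∈ nonnegCoeffs)
    (hFG : G - F ∈ nonnegCoeffs) (n : ℕ) : G ^ n - F ^ n ∈ nonnegCoeffs := by
  rw [← (Commute.all G F).geom_sum₂_mul]
  exact mul_mem (sum_mem fun i _ => mul_mem (pow_mem hG _) (pow_mem hF _)) hFG

theorem hasSum_mul_pow_of_one_sub_mul_eq (hF : constantCoeff F = 0) (h : (1 - F) * G = H) :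
    HasSum (fun i : ℕ => H * F ^ i) G := by
  have hsum := (WithPiTopology.summable_pow_of_constantCoeff_eq_zero hF).hasSum.mul_left H
  rwa [← h, mul_right_comm, WithPiTopology.one_sub_mul_tsum_pow_of_constantCoeff_eq_zero hF,
    one_mul, h] at hsum

namespace HasValueAt

theorem unique (hF : HasValueAt F x a) (hF' : HasValueAt F x b) : a = b :=
  HasSum.unique hF hF'

theorem nonneg (hx : 0 ≤ x) (hF : F ∈ nonnegCoeffs) (ha : HasValueAt F x a) : 0 ≤ a :=
  HasSum.nonneg (fun n => mul_nonneg (hF n) (pow_nonneg hx n)) ha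

theorem const (c x : ℝ) : HasValueAt (C c) x c := by
  have h := hasSum_single (f := fun n => coeff n (C c) * x ^ n) 0 fun n hn => by
    simp [coeff_C, hn]
  simpa [HasValueAt] using h

theorem var (x : ℝ) : HasValueAt X x x := by
  have h := hasSum_single (f := fun n => coeff n (X : ℝ⟦X⟧) * x ^ n) 1 fun n hn => by
    simp [coeff_X, hn]
  simpa [HasValueAt] using h

theorem add (hF : HasValueAt F x a) (hG : HasValueAt G x b) : HasValueAt (F + G) x (a + b) := by
  simpa only [HasValueAt, map_add, add_mul] using HasSum.add hF hG

theorem sub (hF : HasValueAt F x a) (hG : HasValueAt G x b) : HasValueAt (F - G) x (a - b) := by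
  simpa only [HasValueAt, map_sub, sub_mul] using HasSum.sub hF hG

theorem sum {ι : Type*} {Q : ι → ℝ⟦X⟧} {v : ι → ℝ} (s : Finset ι)
    (h : ∀ i ∈ s, HasValueAt (Q i) x (v i)) : HasValueAt (∑ i ∈ s, Q i) x (∑ i ∈ s, v i) := by
  simpa only [HasValueAt, map_sum, Finset.sum_mul] using hasSum_sum h

theorem mul (hF : HasValueAt F x a) (hG : HasValueAt G x b) : HasValueAt (F * G) x (a * b) := by
  have hF' := hF.summable.norm
  have hG' := hG.summable.norm
  have hcoeff (n : ℕ) : coeff n (F * G) * x ^ n = ∑ p ∈ antidiagonal n,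
      coeff p.1 F * x ^ p.1 * (coeff p.2 G * x ^ p.2) := by
    rw [coeff_mul, Finset.sum_mul]
    refine Finset.sum_congr rfl fun p hp => ?_
    rw [← mem_antidiagonal.1 hp, pow_add]
    ring
  rw [HasValueAt, ← hF.tsum_eq, ← hG.tsum_eq,
    tsum_mul_tsum_eq_tsum_sum_antidiagonal_of_summable_norm hF' hG']
  simp only [hcoeff]
  exact (summable_norm_sum_mul_antidiagonal_of_summable_norm hF' hG').of_norm.hasSum

theorem pow (hF : HasValueAt F x a) (n : ℕ) : HasValueAt (F ^ n) x (a ^ n) := by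
  induction n with
  | zero => simpa using const 1 x
  | succ n ih => simpa only [pow_succ] using ih.mul hF

theorem of_hasSum {ι : Type*} {Q : ι → ℝ⟦X⟧} {v : ι → ℝ} (hx : 0 ≤ x)
    (hQ : ∀ i, Q i ∈ nonnegCoeffs) (hv : ∀ i, HasValueAt (Q i) x (v i)) (hF : HasSum Q F)
    (ha : HasSum v a) : HasValueAt F x a := by
  have hcoeff (n : ℕ) : HasSum (fun i => coeff n (Q i) * x ^ n) (coeff n F * x ^ n) :=
    ((WithPiTopology.hasSum_iff_hasSum_coeff ℝ).1 hF n).mul_right _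
  have hsum : Summable fun p : ι × ℕ => coeff p.2 (Q p.1) * x ^ p.2 :=
    (summable_prod_of_nonneg fun p => mul_nonneg (hQ p.1 p.2) (pow_nonneg hx p.2)).2
      ⟨fun i => (hv i).summable, by simpa only [(hv _).tsum_eq] using ha.summable⟩
  have hdouble := hsum.hasSum
  rw [(hdouble.prod_fiberwise hv).unique ha] at hdouble
  exact ((Equiv.prodComm ℕ ι).hasSum_iff.2 hdouble).prod_fiberwise hcoeff

theorem of_one_sub_mul_eq (hx : 0 ≤ x) (hF : F ∈ nonnegCoeffs) (hH : H ∈ nonnegCoeffs)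
    (hF0 : constantCoeff F = 0) (h : (1 - F) * G = H) (ha : HasValueAt F x a) (ha1 : a < 1)
    (hc : HasValueAt H x c) : HasValueAt G x (c / (1 - a)) :=
  of_hasSum hx (fun i => mul_mem hH (pow_mem hF i)) (fun i => hc.mul (ha.pow i))
    (hasSum_mul_pow_of_one_sub_mul_eq hF0 h)
    ((hasSum_geometric_of_lt_one (ha.nonneg hx hF) ha1).mul_left c)

theorem mul_hasResidueAt (hF : HasValueAt F x a) (hG : HasResidueAt G x b) :
    HasResidueAt (F * G) x (a * b) := by
  rw [HasResidueAt, mul_left_comm]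
  exact hF.mul hG

theorem hasResidueAt_zero (hF : HasValueAt F x a) : HasResidueAt F x 0 := by
  simpa [HasResidueAt] using ((const x x).sub (var x)).mul hF

theorem coeff_mul_le (hx : 0 ≤ x) (hF : F ∈ nonnegCoeffs) (ha : HasValueAt F x a) {M : ℝ}
    (hM : 0 ≤ M) (hG : ∀ n, coeff n G * x ^ (n + 1) ≤ M) (n : ℕ) :
    coeff n (F * G) * x ^ (n + 1) ≤ a * M := by
  calc coeff n (F * G) * x ^ (n + 1)
      = ∑ p ∈ antidiagonal n, coeff p.1 F * x ^ p.1 * (coeff p.2 G * x ^ (p.2 + 1)) := by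
        rw [coeff_mul, Finset.sum_mul]
        refine Finset.sum_congr rfl fun p hp => ?_
        rw [← mem_antidiagonal.1 hp, add_assoc, pow_add]
        ring
    _ ≤ ∑ p ∈ antidiagonal n, coeff p.1 F * x ^ p.1 * M :=
        Finset.sum_le_sum fun p _ =>
          mul_le_mul_of_nonneg_left (hG p.2) (mul_nonneg (hF p.1) (pow_nonneg hx p.1))
    _ = (∑ i ∈ Finset.range (n + 1), coeff i F * x ^ i) * M := by
        rw [Finset.sum_mul, Finset.Nat.sum_antidiagonal_eq_sum_range_succ_mk]
    _ ≤ a * M := mul_le_mul_of_nonneg_right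
        (sum_le_hasSum _ (fun i _ => mul_nonneg (hF i) (pow_nonneg hx i)) ha) hM

end HasValueAt

namespace HasResidueAt

theorem sub (hF : HasResidueAt F x a) (hG : HasResidueAt G x b) :
    HasResidueAt (F - G) x (a - b) := by
  simpa only [HasResidueAt, mul_sub] using HasValueAt.sub hF hG

theorem tendsto_coeff (hF : HasResidueAt F x b) :
    Tendsto (fun n => coeff n F * x ^ (n + 1)) atTop (𝓝 b) := by
  have htelescope (n : ℕ) :
      ∑ i ∈ Finset.range (n + 1), coeff i ((C x - X) * F) * x ^ i = coeff n F * x ^ (n + 1) := by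
    induction n with
    | zero => simp [mul_comm]
    | succ n ih =>
      rw [Finset.sum_range_succ, ih, sub_mul, map_sub, coeff_C_mul, coeff_succ_X_mul]
      ring
  simpa only [Function.comp_def, htelescope] using
    (HasSum.tendsto_sum_nat hF).comp (tendsto_add_atTop_nat 1)

end HasResidueAt

end PowerSeriesValues

namespace PlaneTree

/-! ### Finite generations, sizes and heights -/

theorem mem_of_append (T : PlaneTree) {v w : List ℕ} (h : v ++ w ∈ T.verts) : v ∈ T.verts := by
  induction w using List.reverseRecOn with
  | nil => simpa using h
  | append_singleton w i ih =>
    rw [← List.append_assoc] at h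
    exact ih (T.parent_mem _ _ h)

theorem take_mem (T : PlaneTree) {v : List ℕ} (hv : v ∈ T.verts) (r : ℕ) : v.take r ∈ T.verts :=
  T.mem_of_append (w := v.drop r) (by simpa using hv)

theorem take_mem_level {T : PlaneTree} {v : List ℕ} {r : ℕ} (hv : v ∈ T.verts)
    (hr : r ≤ v.length) : v.take r ∈ T.level r :=
  ⟨T.take_mem hv r, by simpa using hr⟩

theorem append_singleton_mem_of_le (T : PlaneTree) {v : List ℕ} {i j : ℕ}
    (h : v ++ [i] ∈ T.verts) (hj : j ≤ i) : v ++ [j] ∈ T.verts := by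
  obtain ⟨n, hn⟩ := T.offspring v (T.parent_mem _ _ h)
  rw [hn] at h ⊢
  exact hj.trans_lt h

theorem singleton_zero_mem (T : PlaneTree) : [0] ∈ T.verts := (T.root_edge 0).2 rfl

theorem eq_zero_of_cons_mem (T : PlaneTree) {i : ℕ} {w : List ℕ} (h : i :: w ∈ T.verts) : i = 0 :=
  (T.root_edge i).1 (T.mem_of_append (v := [i]) h)

theorem ext_cons {T T' : PlaneTree} (h : ∀ w, 0 :: w ∈ T.verts ↔ 0 :: w ∈ T'.verts) : T = T' := by
  ext v
  rcases v with _ | ⟨i, w⟩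
  · simp only [T.root_mem, T'.root_mem]
  · rcases eq_or_ne i 0 with rfl | hi
    · exact h w
    · exact iff_of_false (fun h => hi (T.eq_zero_of_cons_mem h))
        fun h => hi (T'.eq_zero_of_cons_mem h)

theorem size_eq_encard_verts (T : PlaneTree) : T.size = (T.verts \ {[]}).encard := by
  have hedges : T.edges = (fun v : List ℕ => s(v, v.dropLast)) '' (T.verts \ {[]}) := by
    ext e
    constructor
    · rintro ⟨v, i, hv, rfl⟩
      exact ⟨v ++ [i], ⟨hv, by simp⟩, by simp⟩
    · rintro ⟨v, ⟨hv, hne⟩, rfl⟩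
      obtain rfl | ⟨w, i, rfl⟩ := List.eq_nil_or_concat' v
      · exact absurd rfl hne
      · exact ⟨w, i, hv, by simp⟩
  rw [size, hedges]
  refine Set.InjOn.encard_image ?_
  rintro v - w ⟨-, hw⟩ hvw
  rcases Sym2.eq_iff.1 hvw with h | ⟨h, h'⟩
  · exact h.1
  · have hlen := congrArg List.length h
    have hlen' := congrArg List.length h'
    have hpos := List.length_pos_iff.2 hw
    simp only [List.length_dropLast] at hlen hlen'
    omega

theorem size_ne_top_iff {T : PlaneTree} : T.size ≠ ⊤ ↔ T.verts.Finite := by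
  rw [size_eq_encard_verts, Set.encard_ne_top_iff]
  exact ⟨fun h => h.of_sdiff (Set.finite_singleton _), fun h => h.sdiff⟩

theorem height_le_iff {T : PlaneTree} {m : ℕ} : T.height ≤ m ↔ ∀ v ∈ T.verts, v.length ≤ m := by
  simp only [height, iSup_le_iff, Nat.cast_le]
  constructor
  · exact fun h v hv => h v.length ⟨v, hv, rfl⟩
  · rintro h r ⟨v, hv, rfl⟩
    exact h v hv

theorem height_le_of_level_succ_eq_empty {T : PlaneTree} {s : ℕ} (h : T.level (s + 1) = ∅) :
    T.height ≤ s := by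
  refine height_le_iff.2 fun v hv => ?_
  by_contra! hlt
  exact h.le (take_mem_level hv hlt)

theorem height_eq_of_nonempty_level {T : PlaneTree} {r : ℕ} (hle : T.height ≤ r)
    (h : (T.level r).Nonempty) : T.height = r :=
  hle.antisymm (le_iSup₂_of_le r h le_rfl)

theorem one_le_height (T : PlaneTree) : 1 ≤ T.height :=
  le_iSup₂_of_le 1 ⟨[0], T.singleton_zero_mem, rfl⟩ le_rfl

theorem one_le_size (T : PlaneTree) : 1 ≤ T.size := by
  rw [size_eq_encard_verts, Set.one_le_encard_iff_nonempty]
  exact ⟨[0], T.singleton_zero_mem, by simp⟩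

theorem card_le_size {T : PlaneTree} {n : ℕ} (f : Fin n → List ℕ) (hf : Function.Injective f)
    (hmem : ∀ i, f i ∈ T.verts \ {[]}) : (n : ℕ∞) ≤ T.size := by
  rw [size_eq_encard_verts]
  calc (n : ℕ∞) = (Set.range f).encard := by
        rw [← Set.image_univ, hf.encard_image, Set.encard_univ]
        simp
    _ ≤ _ := Set.encard_le_encard (Set.range_subset_iff.2 hmem)

theorem height_le_size (T : PlaneTree) : T.height ≤ T.size := by
  refine iSup₂_le fun r hr => ?_
  obtain ⟨v, hv, rfl⟩ := hr
  have hlen (i : Fin v.length) : (v.take (i + 1)).length = i + 1 := by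
    rw [List.length_take, min_eq_left (Nat.succ_le_of_lt i.2)]
  refine card_le_size (fun i => v.take (i + 1)) (fun i j hij => ?_) fun i =>
    ⟨T.take_mem hv _, fun h => ?_⟩
  · have h := congrArg List.length hij
    rw [hlen, hlen] at h
    exact Fin.ext (Nat.succ_injective h)
  · have h' := congrArg List.length h
    simp [hlen] at h'

theorem lt_size_of_append_singleton_mem {T : PlaneTree} {v : List ℕ} {i : ℕ}
    (hv : v ++ [i] ∈ T.verts) : ((i + 1 : ℕ) : ℕ∞) ≤ T.size :=
  card_le_size (fun j => v ++ [(j : ℕ)]) (fun _ _ h => Fin.ext (by simpa using h)) fun j =>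
    ⟨T.append_singleton_mem_of_le hv (Nat.le_of_lt_succ j.2), by simp⟩

theorem finite_setOf_size_eq (N : ℕ) : {T : PlaneTree | T.size = N}.Finite := by
  have hwords : (List.map Fin.val '' {l : List (Fin N) | l.length ≤ N}).Finite :=
    (List.finite_length_le (Fin N) N).image _
  refine Set.Finite.of_finite_image (f := PlaneTree.verts) (hwords.finite_subsets.subset ?_)
    fun T _ T' _ h => PlaneTree.ext h
  rintro _ ⟨T, hT : T.size = N, rfl⟩ v hv
  have hentries : v ∈ Set.range (List.map (Fin.val : Fin N → ℕ)) := by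
    rw [Set.range_list_map]
    intro i hi
    obtain ⟨a, b, rfl⟩ := List.append_of_mem hi
    have ha : a ++ [i] ∈ T.verts := T.mem_of_append (w := b) (by simpa using hv)
    have hlt := lt_size_of_append_singleton_mem ha
    rw [hT, Nat.cast_le] at hlt
    exact ⟨⟨i, hlt⟩, rfl⟩
  obtain ⟨l, rfl⟩ := hentries
  refine ⟨l, ?_, rfl⟩
  simpa using height_le_iff.1 (hT ▸ T.height_le_size) _ hv

/-- The finitely many trees with `N` edges. -/
noncomputable def treesOfSize (N : ℕ) : Finset PlaneTree := (finite_setOf_size_eq N).toFinset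

@[simp]
theorem mem_treesOfSize {N : ℕ} {T : PlaneTree} : T ∈ treesOfSize N ↔ T.size = N := by
  simp [treesOfSize]

theorem countable_setOf_size_ne_top : {T : PlaneTree | T.size ≠ ⊤}.Countable := by
  refine (Set.countable_iUnion fun N : ℕ => (finite_setOf_size_eq N).countable).mono fun T hT => ?_
  exact Set.mem_iUnion.2 ⟨T.size.toNat, (ENat.natCast_toNat hT).symm⟩

theorem finite_level (T : PlaneTree) (r : ℕ) : (T.level r).Finite := by
  induction r with
  | zero => exact (Set.finite_singleton []).subset fun v hv => List.length_eq_zero_iff.1 hv.2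
  | succ r ih =>
    have hchildren : ∀ v ∈ T.level r, {w ∈ T.verts | ∃ i, w = v ++ [i]}.Finite := by
      intro v hv
      obtain ⟨n, hn⟩ := T.offspring v hv.1
      refine ((Set.finite_Iio n).image fun i => v ++ [i]).subset ?_
      rintro _ ⟨hw, i, rfl⟩
      exact ⟨i, (hn i).1 hw, rfl⟩
    refine (ih.biUnion hchildren).subset ?_
    rintro w ⟨hw, hlen⟩
    obtain rfl | ⟨v, i, rfl⟩ := List.eq_nil_or_concat' w
    · simp at hlen
    · exact Set.mem_biUnion (x := v) ⟨T.parent_mem _ _ hw, by simpa using hlen⟩ ⟨hw, i, rfl⟩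

noncomputable instance (T : PlaneTree) (r : ℕ) : Fintype (T.level r) := (T.finite_level r).fintype

theorem finite_rootBall (T : PlaneTree) (r : ℕ) : (T.rootBall r).Finite :=
  ((Set.finite_Iic r).biUnion fun n _ => T.finite_level n).subset fun v hv =>
    Set.mem_biUnion (x := v.length) hv.2 ⟨hv.1, rfl⟩

/-! ### Cylinders and truncations -/

theorem rootBall_eq_iff {T T' : PlaneTree} {r : ℕ} : T.rootBall r = T'.rootBall r ↔
    ∀ v : List ℕ, v.length ≤ r → (v ∈ T.verts ↔ v ∈ T'.verts) := by
  simp only [Set.ext_iff, rootBall, Set.mem_ofPred_eq, and_congr_left_iff]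

/-- The trees that have the same ball of radius `r` around the root as `T₀`. -/
def cylinder (T₀ : PlaneTree) (r : ℕ) : Set PlaneTree := {T | T.rootBall r = T₀.rootBall r}

theorem mem_cylinder_self (T : PlaneTree) (r : ℕ) : T ∈ cylinder T r := rfl

theorem cylinder_eq_of_mem {T T₀ : PlaneTree} {r : ℕ} (h : T ∈ cylinder T₀ r) :
    cylinder T r = cylinder T₀ r := by
  rw [cylinder, show T.rootBall r = T₀.rootBall r from h, cylinder]

theorem cylinder_anti (T : PlaneTree) : Antitone (cylinder T) := fun _ _ hrs _ h =>
  rootBall_mono h hrs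

theorem mem_verts_iff_of_mem_cylinder {T T₀ : PlaneTree} {r : ℕ} (h : T ∈ cylinder T₀ r)
    {v : List ℕ} (hv : v.length ≤ r) : v ∈ T.verts ↔ v ∈ T₀.verts :=
  rootBall_eq_iff.1 h v hv

theorem level_eq_of_mem_cylinder {T T₀ : PlaneTree} {r : ℕ} (h : T ∈ cylinder T₀ r) :
    T.level r = T₀.level r :=
  Set.ext fun _ => and_congr_left fun hv => mem_verts_iff_of_mem_cylinder h hv.le

theorem cylinder_eq_singleton {T₀ : PlaneTree} {s : ℕ} (h : T₀.level (s + 1) = ∅) :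
    cylinder T₀ (s + 1) = {T₀} := by
  refine Set.eq_singleton_iff_unique_mem.2 ⟨mem_cylinder_self T₀ _, fun T hT => ?_⟩
  have hheight := height_le_iff.1 (height_le_of_level_succ_eq_empty h)
  have hheight' := height_le_iff.1
    (height_le_of_level_succ_eq_empty ((level_eq_of_mem_cylinder hT).trans h))
  ext v
  exact ⟨fun hv => (mem_verts_iff_of_mem_cylinder hT ((hheight' v hv).trans s.le_succ)).1 hv,
    fun hv => (mem_verts_iff_of_mem_cylinder hT ((hheight v hv).trans s.le_succ)).2 hv⟩

theorem closedBall_eq_cylinder (T₀ : PlaneTree) {r : ℕ} (hr : 1 ≤ r) :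
    Metric.closedBall T₀ (1 / (r : ℝ)) = cylinder T₀ r := by
  have hr1 : (1 : ℝ) ≤ r := by exact_mod_cast hr
  ext T
  refine ⟨fun h => ?_, fun h => dist_le_of_mem ⟨r, hr, h, rfl⟩⟩
  have hlt : sInf (agreeRadii T T₀) < 1 / (r - 1 / 2 : ℝ) := by
    refine (Metric.mem_closedBall.1 h).trans_lt ?_
    apply one_div_lt_one_div_of_lt <;> linarith
  obtain ⟨a, ⟨s, hs, hball, rfl⟩, ha⟩ := exists_lt_of_csInf_lt (agreeRadii_nonempty T T₀) hlt
  have hrs : (r : ℝ) - 1 / 2 < s := lt_of_one_div_lt_one_div (by exact_mod_cast hs) ha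
  have hrs' : (r : ℝ) < (s + 1 : ℕ) := by push_cast; linarith
  exact rootBall_mono hball (Nat.lt_succ_iff.1 (Nat.cast_lt.1 hrs'))

/-- The truncation of a tree at height `s + 1`; it is the canonical representative of the cylinder
of radius `s + 1` around the tree. -/
def trunc (T : PlaneTree) (s : ℕ) : PlaneTree where
  verts := T.rootBall (s + 1)
  root_mem := ⟨T.root_mem, by simp⟩
  parent_mem v i h := ⟨T.parent_mem v i h.1, (by simpa using h.2 : v.length ≤ s).trans s.le_succ⟩
  offspring v hv := by
    obtain ⟨n, hn⟩ := T.offspring v hv.1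
    by_cases h : v.length ≤ s
    · exact ⟨n, fun i => by simp [rootBall, hn, h]⟩
    · exact ⟨0, fun i => by simp [rootBall, h]⟩
  root_edge i := by simp [rootBall, T.root_edge]

theorem trunc_mem_cylinder (T : PlaneTree) (s : ℕ) : T.trunc s ∈ cylinder T (s + 1) :=
  rootBall_eq_iff.2 fun v hv => by simp [trunc, rootBall, hv]

theorem cylinder_trunc (T : PlaneTree) (s : ℕ) :
    cylinder (T.trunc s) (s + 1) = cylinder T (s + 1) :=
  cylinder_eq_of_mem (T.trunc_mem_cylinder s)

theorem trunc_eq_trunc_iff {T T₀ : PlaneTree} {s : ℕ} :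
    T.trunc s = T₀.trunc s ↔ T ∈ cylinder T₀ (s + 1) :=
  PlaneTree.ext_iff

theorem trunc_trunc (T : PlaneTree) (s : ℕ) : (T.trunc s).trunc s = T.trunc s :=
  trunc_eq_trunc_iff.2 (T.trunc_mem_cylinder s)

theorem size_trunc_ne_top (T : PlaneTree) (s : ℕ) : (T.trunc s).size ≠ ⊤ :=
  size_ne_top_iff.2 (T.finite_rootBall (s + 1))

theorem height_trunc_eq {T : PlaneTree} {s : ℕ} (h : (T.level (s + 1)).Nonempty) :
    (T.trunc s).height = (s + 1 : ℕ) :=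
  height_eq_of_nonempty_level (height_le_iff.2 fun _ hv => hv.2)
    (by rwa [level_eq_of_mem_cylinder (T.trunc_mem_cylinder s)])

/-! ### Grafting -/

/-- The part of `T` above a vertex `v`, planted on a single edge that stands for the edge below
`v`. -/
def branch (T : PlaneTree) (v : List ℕ) (hv : v ∈ T.verts) : PlaneTree where
  verts := {w | w = [] ∨ ∃ w', w = 0 :: w' ∧ v ++ w' ∈ T.verts}
  root_mem := Or.inl rfl
  parent_mem w i h := by
    obtain h | ⟨w', h, hw⟩ := h
    · simp at h
    · rcases w with _ | ⟨j, w⟩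
      · exact Or.inl rfl
      · obtain ⟨rfl, rfl⟩ := List.cons_eq_cons.1 h
        exact Or.inr ⟨w, rfl, T.parent_mem _ i (by simpa using hw)⟩
  offspring w hw := by
    obtain rfl | ⟨w', rfl, hw⟩ := hw
    · exact ⟨1, fun i => by simpa using fun _ => hv⟩
    · obtain ⟨n, hn⟩ := T.offspring _ hw
      exact ⟨n, fun i => by simp [← hn]⟩
  root_edge i := by simpa using fun _ => hv

theorem cons_mem_branch {T : PlaneTree} {v : List ℕ} (hv : v ∈ T.verts) (w : List ℕ) :
    0 :: w ∈ (T.branch v hv).verts ↔ v ++ w ∈ T.verts := by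
  simp [branch]

section graft

variable (T₀ : PlaneTree) (s : ℕ) (f : T₀.level (s + 1) → PlaneTree)

/-- The vertices of the tree that arises from `T₀` when, at each vertex `v` at distance `s + 1` from
the root, the edge below `v` and everything above `v` are replaced by `f v`. -/
def graftVerts : Set (List ℕ) :=
  {w | (w ∈ T₀.verts ∧ w.length ≤ s) ∨
    ∃ (v : T₀.level (s + 1)) (w' : List ℕ), w = v.1 ++ w' ∧ 0 :: w' ∈ (f v).verts}

variable {T₀ s f}

theorem exists_eq_append_of_mem_graftVerts {w : List ℕ} (hw : w ∈ graftVerts T₀ s f)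
    (hlen : s < w.length) :
    ∃ (v : T₀.level (s + 1)) (w' : List ℕ), w = v.1 ++ w' ∧ 0 :: w' ∈ (f v).verts :=
  hw.resolve_left fun h => hlen.not_ge h.2

theorem mem_graftVerts_of_length_le {w : List ℕ} (hw : w.length ≤ s + 1) :
    w ∈ graftVerts T₀ s f ↔ w ∈ T₀.verts := by
  refine ⟨?_, fun h => ?_⟩
  · rintro (h | ⟨v, w', rfl, -⟩)
    · exact h.1
    · rw [List.length_append, v.2.2, add_le_iff_nonpos_right, nonpos_iff_eq_zero,
        List.length_eq_zero_iff] at hw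
      rw [hw, List.append_nil]
      exact v.2.1
  · rcases Nat.le_succ_iff.1 hw with hs | hs
    · exact Or.inl ⟨h, hs⟩
    · exact Or.inr ⟨⟨w, h, hs⟩, [], by simp, (f _).singleton_zero_mem⟩

theorem eq_of_append_eq_append_of_mem_level {T : PlaneTree} {r : ℕ} {v v' : T.level r}
    {w w' : List ℕ} (h : v.1 ++ w = v'.1 ++ w') : v = v' ∧ w = w' :=
  (List.append_inj h (v.2.2.trans v'.2.2.symm)).imp_left Subtype.ext

theorem append_mem_graftVerts (v : T₀.level (s + 1)) (w : List ℕ) :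
    v.1 ++ w ∈ graftVerts T₀ s f ↔ 0 :: w ∈ (f v).verts := by
  refine ⟨fun h => ?_, fun h => Or.inr ⟨v, w, rfl, h⟩⟩
  have hlen : s < (v.1 ++ w).length := by
    rw [List.length_append, v.2.2]
    omega
  obtain ⟨v', w', heq, h'⟩ := exists_eq_append_of_mem_graftVerts h hlen
  obtain ⟨rfl, rfl⟩ := eq_of_append_eq_append_of_mem_level heq
  exact h'

variable (T₀ s f)

/-- The tree that arises from `T₀` when, at each vertex `v` at distance `s + 1` from the root, the
edge below `v` and everything above `v` are replaced by `f v`. -/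
def graft : PlaneTree where
  verts := graftVerts T₀ s f
  root_mem := (mem_graftVerts_of_length_le (by simp)).2 T₀.root_mem
  parent_mem v i h := by
    have hlen : (v ++ [i]).length = v.length + 1 := by simp
    rcases le_or_gt v.length s with hs | hs
    · rw [mem_graftVerts_of_length_le (by omega)] at h ⊢
      exact T₀.parent_mem v i h
    · obtain ⟨u, w, heq, hw⟩ := exists_eq_append_of_mem_graftVerts h (by omega)
      obtain rfl | ⟨w, j, rfl⟩ := List.eq_nil_or_concat' w
      · rw [heq, List.append_nil, u.2.2] at hlen
        omega
      · rw [← List.append_assoc] at heq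
        obtain ⟨rfl, -⟩ := List.append_inj' heq rfl
        exact (append_mem_graftVerts u w).2 ((f u).parent_mem (0 :: w) j hw)
  offspring v hv := by
    rcases le_or_gt v.length s with hs | hs
    · rw [mem_graftVerts_of_length_le (hs.trans s.le_succ)] at hv
      obtain ⟨n, hn⟩ := T₀.offspring v hv
      exact ⟨n, fun i => by rw [mem_graftVerts_of_length_le (by simpa using hs), hn]⟩
    · obtain ⟨u, w, rfl, hw⟩ := exists_eq_append_of_mem_graftVerts hv hs
      obtain ⟨n, hn⟩ := (f u).offspring _ hw
      exact ⟨n, fun i => by rw [List.append_assoc, append_mem_graftVerts, ← hn, List.cons_append]⟩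
  root_edge i := by rw [mem_graftVerts_of_length_le (by simp), T₀.root_edge]

theorem graft_mem_cylinder : graft T₀ s f ∈ cylinder T₀ (s + 1) :=
  rootBall_eq_iff.2 fun _ => mem_graftVerts_of_length_le

theorem mem_verts_of_mem_level_of_mem_cylinder {T T₀ : PlaneTree} {r : ℕ} (h : T ∈ cylinder T₀ r)
    (v : T₀.level r) : v.1 ∈ T.verts :=
  (mem_verts_iff_of_mem_cylinder h v.2.2.le).2 v.2.1

theorem ext_of_mem_cylinder {T T' T₀ : PlaneTree} {r : ℕ} (hT : T ∈ cylinder T₀ r)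
    (hT' : T' ∈ cylinder T₀ r)
    (h : ∀ (v : T₀.level r) w, v.1 ++ w ∈ T.verts ↔ v.1 ++ w ∈ T'.verts) : T = T' := by
  ext w
  rcases le_or_gt w.length r with hw | hw
  · rw [mem_verts_iff_of_mem_cylinder hT hw, mem_verts_iff_of_mem_cylinder hT' hw]
  · have htake {S : PlaneTree} (hS : S ∈ cylinder T₀ r) (hwS : w ∈ S.verts) :
        w ∈ T.verts ↔ w ∈ T'.verts := by
      have hv : w.take r ∈ T₀.level r :=
        level_eq_of_mem_cylinder hS ▸ take_mem_level hwS hw.le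
      simpa using h ⟨_, hv⟩ (w.drop r)
    exact ⟨fun hw => (htake hT hw).1 hw, fun hw => (htake hT' hw).2 hw⟩

/-- A tree in the cylinder of radius `s + 1` around `T₀` is the same as a family of trees indexed by
the vertices of `T₀` at distance `s + 1` from the root. -/
def graftEquiv : (T₀.level (s + 1) → PlaneTree) ≃ cylinder T₀ (s + 1) where
  toFun f := ⟨graft T₀ s f, graft_mem_cylinder T₀ s f⟩
  invFun T v := T.1.branch v.1 (mem_verts_of_mem_level_of_mem_cylinder T.2 v)
  left_inv _ := funext fun v => ext_cons fun w =>
    (cons_mem_branch _ w).trans (append_mem_graftVerts v w)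
  right_inv T := Subtype.ext <| ext_of_mem_cylinder (graft_mem_cylinder T₀ s _) T.2 fun v w =>
    (append_mem_graftVerts v w).trans (cons_mem_branch _ w)

theorem height_graft_le_iff (m : ℕ) :
    (graft T₀ s f).height ≤ (s + m : ℕ) ↔ ∀ v, (f v).height ≤ m := by
  simp only [height_le_iff]
  constructor
  · rintro h v (_ | ⟨i, w⟩) hw
    · exact zero_le
    · obtain rfl := (f v).eq_zero_of_cons_mem hw
      have hlen := h _ ((append_mem_graftVerts v w).2 hw)
      rw [List.length_append, v.2.2] at hlen
      rw [List.length_cons]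
      omega
  · rintro h w (⟨-, hw⟩ | ⟨v, w', rfl, hw⟩)
    · exact hw.trans (Nat.le_add_right s m)
    · have hlen := h v _ hw
      rw [List.length_cons] at hlen
      rw [List.length_append, v.2.2]
      omega

/-- The number of edges of `T` whose endpoints both have distance at most `s` from the root: those
that grafting at level `s + 1` keeps. -/
noncomputable def coreSize (T : PlaneTree) (s : ℕ) : ℕ := (T.rootBall s \ {[]}).ncard

theorem cast_coreSize (T : PlaneTree) (s : ℕ) :
    (T.coreSize s : ℕ∞) = (T.rootBall s \ {[]}).encard :=
  (T.finite_rootBall s).sdiff.cast_ncard_eq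

theorem graft_verts_sdiff : (graft T₀ s f).verts \ {[]} = (T₀.rootBall s \ {[]}) ∪
    ⋃ v : T₀.level (s + 1), (fun w : List ℕ => v.1 ++ w.tail) '' ((f v).verts \ {[]}) := by
  ext w
  constructor
  · rintro ⟨h | ⟨v, w', rfl, h⟩, hne⟩
    · exact Or.inl ⟨h, hne⟩
    · exact Or.inr (Set.mem_iUnion.2 ⟨v, 0 :: w', ⟨h, by simp⟩, rfl⟩)
  · rintro (⟨h, hne⟩ | h)
    · exact ⟨Or.inl h, hne⟩
    · obtain ⟨v, _ | ⟨i, w⟩, ⟨hw, hne⟩, rfl⟩ := Set.mem_iUnion.1 h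
      · exact absurd rfl hne
      · obtain rfl := (f v).eq_zero_of_cons_mem hw
        refine ⟨(append_mem_graftVerts v w).2 hw, fun h0 => ?_⟩
        have hlen := congrArg List.length h0
        simp [v.2.2] at hlen

theorem size_graft : (graft T₀ s f).size = T₀.coreSize s + ∑ v, (f v).size := by
  have htail (T : PlaneTree) (v : List ℕ) :
      Set.InjOn (fun w : List ℕ => v ++ w.tail) (T.verts \ {[]}) := by
    rintro (_ | ⟨i, a⟩) ⟨ha, ha0⟩ (_ | ⟨j, b⟩) ⟨hb, hb0⟩ hab
    · rfl
    · exact absurd rfl ha0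
    · exact absurd rfl hb0
    · obtain rfl := T.eq_zero_of_cons_mem ha
      obtain rfl := T.eq_zero_of_cons_mem hb
      simpa using hab
  rw [size_eq_encard_verts, graft_verts_sdiff, Set.encard_union_eq, Set.encard_iUnion_of_finite,
    finsum_eq_sum_of_fintype, cast_coreSize]
  · simp only [(htail _ _).encard_image, size_eq_encard_verts]
  · intro v v' hne
    refine Set.disjoint_left.2 ?_
    rintro _ ⟨a, -, rfl⟩ ⟨b, -, hb⟩
    exact hne (eq_of_append_eq_append_of_mem_level hb).1.symm
  · refine Set.disjoint_left.2 fun a ha hb => ?_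
    obtain ⟨v, w, -, rfl⟩ := Set.mem_iUnion.1 hb
    have hlen := ha.1.2
    simp only [List.length_append, v.2.2] at hlen
    omega

theorem size_eq_coreSize_add {T : PlaneTree} {s : ℕ} (hT : T.height ≤ (s + 1 : ℕ)) :
    T.size = T.coreSize s + (T.level (s + 1)).encard := by
  have hverts : T.verts \ {[]} = (T.rootBall s \ {[]}) ∪ T.level (s + 1) := by
    ext v
    constructor
    · rintro ⟨hv, hne⟩
      rcases Nat.le_succ_iff.1 (height_le_iff.1 hT v hv) with h | h
      · exact Or.inl ⟨⟨hv, h⟩, hne⟩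
      · exact Or.inr ⟨hv, h⟩
    · rintro (⟨⟨hv, -⟩, hne⟩ | ⟨hv, hlen⟩)
      · exact ⟨hv, hne⟩
      · exact ⟨hv, fun h : v = [] => by simp [h] at hlen⟩
  rw [size_eq_encard_verts, hverts, Set.encard_union_eq, cast_coreSize]
  refine Set.disjoint_left.2 ?_
  rintro a ⟨⟨-, ha⟩, -⟩ ⟨-, hb⟩
  omega

end graft

/-! ### Stars -/

/-- The tree of height at most two in which the vertex next to the root has `K` offspring. -/
def star (K : ℕ) : PlaneTree where
  verts := {v | v = [] ∨ v = [0] ∨ ∃ i < K, v = [0, i]}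
  root_mem := Or.inl rfl
  parent_mem v i h := by
    obtain h | h | ⟨j, -, h⟩ := h
    · simp at h
    · exact Or.inl (List.append_inj' (s₂ := []) h rfl).1
    · exact Or.inr (Or.inl (List.append_inj' (s₂ := [0]) h rfl).1)
  offspring v hv := by
    obtain rfl | rfl | ⟨j, -, rfl⟩ := hv
    · exact ⟨1, fun i => by simp⟩
    · exact ⟨K, fun i => by simp⟩
    · exact ⟨0, fun i => by simp⟩
  root_edge i := by simp

theorem coreSize_star (K : ℕ) : (star K).coreSize 1 = 1 := by
  rw [coreSize, rootBall_one, Set.ncard_eq_one]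
  exact ⟨[0], by simp⟩

theorem card_level_star (K : ℕ) : Fintype.card ((star K).level 2) = K := by
  have hlevel : (star K).level 2 = (fun i => [0, i]) '' Set.Iio K := by
    ext v
    constructor
    · rintro ⟨rfl | rfl | ⟨i, hi, rfl⟩, hlen⟩
      · cases hlen
      · cases hlen
      · exact ⟨i, hi, rfl⟩
    · rintro ⟨i, hi, rfl⟩
      exact ⟨Or.inr (Or.inr ⟨i, hi, rfl⟩), rfl⟩
  rw [← Nat.card_eq_fintype_card, Nat.card_coe_set_eq, hlevel,
    Set.ncard_image_of_injective _ fun a b hab => by simpa using hab,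
    Set.ncard_eq_toFinset_card', Set.toFinset_Iio, Nat.card_Iio]

theorem size_star (N : ℕ) : (star N).size = (N + 1 : ℕ) := by
  have hheight : (star N).height ≤ (1 + 1 : ℕ) := by
    refine height_le_iff.2 ?_
    rintro _ (rfl | rfl | ⟨i, -, rfl⟩) <;> simp
  rw [size_eq_coreSize_add hheight, coreSize_star, ← Set.coe_fintypeCard, card_level_star]
  push_cast
  rw [add_comm]

theorem nonempty_treesOfSize (N : ℕ) : (treesOfSize (N + 1)).Nonempty :=
  ⟨star N, mem_treesOfSize.2 (size_star N)⟩

theorem mem_cylinder_star_iff {T : PlaneTree} {K : ℕ} :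
    T ∈ cylinder (star K) 2 ↔ ∀ i, [0, i] ∈ T.verts ↔ i < K := by
  refine ⟨fun h i => ?_, fun h => rootBall_eq_iff.2 ?_⟩
  · rw [mem_verts_iff_of_mem_cylinder h le_rfl]
    simp [star]
  · rintro (_ | ⟨i, _ | ⟨j, _ | ⟨l, v⟩⟩⟩) hv
    · simp only [T.root_mem, (star K).root_mem]
    · rw [T.root_edge, (star K).root_edge]
    · rcases eq_or_ne i 0 with rfl | hi
      · rw [h]
        simp [star]
      · exact iff_of_false (fun h => hi (T.eq_zero_of_cons_mem h))
          fun h => hi ((star K).eq_zero_of_cons_mem h)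
    · simp at hv

theorem existsUnique_mem_cylinder_star (T : PlaneTree) : ∃! K, T ∈ cylinder (star K) 2 := by
  obtain ⟨n, hn⟩ := T.offspring [0] T.singleton_zero_mem
  refine ⟨n, mem_cylinder_star_iff.2 hn, fun K hK => ?_⟩
  exact eq_of_forall_lt_iff fun i => (mem_cylinder_star_iff.1 hK i).symm.trans (hn i)

section series

open PowerSeries
open scoped PowerSeries.WithPiTopology

/-! ### Generating series -/

/-- The generating series by size of the finite trees, each tree `T` counted with weight `w T`. -/
noncomputable def weightedSeries (w : PlaneTree → ℝ) : ℝ⟦X⟧ :=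
  PowerSeries.mk fun N => ∑ T ∈ treesOfSize N, w T

/-- The generating series by size of the finite trees of height at most `m`. -/
noncomputable def heightSeries (m : ℕ) : ℝ⟦X⟧ :=
  weightedSeries ({T : PlaneTree | T.height ≤ m}.indicator 1)

/-- The generating series by size of all finite trees. -/
noncomputable def treeSeries : ℝ⟦X⟧ := weightedSeries 1

theorem coeff_weightedSeries (w : PlaneTree → ℝ) (N : ℕ) :
    coeff N (weightedSeries w) = ∑ T ∈ treesOfSize N, w T := coeff_mk N _

theorem weightedSeries_mem_nonnegCoeffs {w : PlaneTree → ℝ} (hw : 0 ≤ w) :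
    weightedSeries w ∈ nonnegCoeffs := fun N => by
  rw [coeff_weightedSeries]
  exact Finset.sum_nonneg fun T _ => hw T

theorem weightedSeries_sub (w w' : PlaneTree → ℝ) :
    weightedSeries (w - w') = weightedSeries w - weightedSeries w' := by
  ext N
  simp only [coeff_weightedSeries, map_sub, Pi.sub_apply, Finset.sum_sub_distrib]

theorem weightedSeries_smul (c : ℝ) (w : PlaneTree → ℝ) :
    weightedSeries (c • w) = C c * weightedSeries w := by
  ext N
  simp only [coeff_weightedSeries, coeff_C_mul, Pi.smul_apply, smul_eq_mul, Finset.mul_sum]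

theorem constantCoeff_weightedSeries (w : PlaneTree → ℝ) :
    constantCoeff (weightedSeries w) = 0 := by
  rw [← coeff_zero_eq_constantCoeff_apply, coeff_weightedSeries]
  refine Finset.sum_eq_zero fun T hT => absurd T.one_le_size ?_
  simp [mem_treesOfSize.1 hT]

theorem hasSum_weightedSeries_of_size_ne_top {ι : Type*} {w : ι → PlaneTree → ℝ} {W : PlaneTree → ℝ}
    (h : ∀ T : PlaneTree, T.size ≠ ⊤ → HasSum (fun i => w i T) (W T)) :
    HasSum (fun i => weightedSeries (w i)) (weightedSeries W) := by
  refine (WithPiTopology.hasSum_iff_hasSum_coeff ℝ).2 fun N => ?_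
  simp only [coeff_weightedSeries]
  refine hasSum_sum fun T hT => h T ?_
  simp [mem_treesOfSize.1 hT]

theorem hasSum_C_mul_X_pow_size (w : PlaneTree → ℝ) :
    HasSum (fun T : {T : PlaneTree // T.size ≠ ⊤} => C (w T) * X ^ T.1.size.toNat)
      (weightedSeries w) := by
  classical
  refine (WithPiTopology.hasSum_iff_hasSum_coeff ℝ).2 fun N => ?_
  have hfin {T : PlaneTree} (hT : T ∈ treesOfSize N) : T.size ≠ ⊤ := by
    simp [mem_treesOfSize.1 hT]
  have hcoeff (T : {T : PlaneTree // T.size ≠ ⊤}) :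
      coeff N (C (w T) * X ^ T.1.size.toNat) = (treesOfSize N : Set PlaneTree).indicator w T := by
    have hiff : N = T.1.size.toNat ↔ T.1 ∈ (treesOfSize N : Set PlaneTree) := by
      rw [Finset.mem_coe, mem_treesOfSize, ← ENat.natCast_toNat T.2, Nat.cast_inj, eq_comm,
        ENat.toNat_natCast]
    rw [coeff_C_mul, coeff_X_pow, mul_ite, mul_one, mul_zero, Set.indicator_apply]
    exact if_congr hiff rfl rfl
  simp only [hcoeff]
  refine (hasSum_subtype_iff_of_support_subset (s := {T : PlaneTree | T.size ≠ ⊤})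
    (Set.support_indicator_subset.trans fun T hT => hfin (Finset.mem_coe.1 hT))).2 ?_
  rw [coeff_weightedSeries]
  exact hasSum_subtype_iff_indicator.1 (Finset.hasSum (treesOfSize N) w)

theorem hasSum_mul_pow_size {w : PlaneTree → ℝ} {x a : ℝ} (hw : 0 ≤ w) (hx : 0 ≤ x)
    (ha : HasValueAt (weightedSeries w) x a) :
    HasSum (fun T : {T : PlaneTree // T.size ≠ ⊤} => w T * x ^ T.1.size.toNat) a := by
  have hmem (T : {T : PlaneTree // T.size ≠ ⊤}) : C (w T) * X ^ T.1.size.toNat ∈ nonnegCoeffs :=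
    mul_mem (C_mem_nonnegCoeffs (hw T)) (pow_mem X_mem_nonnegCoeffs _)
  have hvalue (T : {T : PlaneTree // T.size ≠ ⊤}) :
      HasValueAt (C (w T) * X ^ T.1.size.toNat) x (w T * x ^ T.1.size.toNat) :=
    (HasValueAt.const _ x).mul ((HasValueAt.var x).pow _)
  have hsum : Summable fun T : {T : PlaneTree // T.size ≠ ⊤} => w T * x ^ T.1.size.toNat := by
    refine summable_of_sum_le (c := a) (fun T => mul_nonneg (hw T) (pow_nonneg hx _)) fun u => ?_
    refine sub_nonneg.1 ((ha.sub (HasValueAt.sum u fun T _ => hvalue T)).nonneg hx fun N => ?_)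
    rw [map_sub, map_sum, sub_nonneg]
    exact sum_le_hasSum u (fun T _ => hmem T N)
      ((WithPiTopology.hasSum_iff_hasSum_coeff ℝ).1 (hasSum_C_mul_X_pow_size w) N)
  rw [ha.unique (.of_hasSum hx hmem hvalue (hasSum_C_mul_X_pow_size w) hsum.hasSum)]
  exact hsum.hasSum

theorem graft_injective (T₀ : PlaneTree) (s : ℕ) : Function.Injective (graft T₀ s) :=
  Subtype.val_injective.comp (graftEquiv T₀ s).injective

theorem exists_graft_eq {T T₀ : PlaneTree} {s : ℕ} (h : T ∈ cylinder T₀ (s + 1)) :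
    ∃ f, graft T₀ s f = T :=
  ((graftEquiv T₀ s).surjective ⟨T, h⟩).imp fun _ => congrArg Subtype.val

theorem coeff_weightedSeries_pow {ι : Type*} [Fintype ι] (w : PlaneTree → ℝ) {M : ℕ}
    {𝓕 : Finset (ι → PlaneTree)} (h𝓕 : ∀ f, f ∈ 𝓕 ↔ ∑ i, (f i).size = M) :
    coeff M (weightedSeries w ^ Fintype.card ι) = ∑ f ∈ 𝓕, ∏ i, w (f i) := by
  classical
  rw [← Finset.card_univ, ← Finset.prod_const, coeff_prod]
  simp only [coeff_weightedSeries, Finset.prod_univ_sum, Finset.sum_sigma']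
  refine Finset.sum_nbij (fun p => p.2) ?_ ?_ ?_ fun _ _ => rfl
  · rintro ⟨l, f⟩ hp
    simp only [Finset.mem_sigma, Fintype.mem_piFinset, mem_treesOfSize,
      Finset.mem_finsuppAntidiag] at hp
    simp only [h𝓕, hp.2, ← hp.1.1, Nat.cast_sum]
  · rintro ⟨l, f⟩ hp ⟨l', f'⟩ hp' (rfl : f = f')
    simp only [Finset.mem_coe, Finset.mem_sigma, Fintype.mem_piFinset, mem_treesOfSize] at hp hp'
    rw [Sigma.mk.injEq]
    exact ⟨Finsupp.ext fun i => Nat.cast_injective ((hp.2 i).symm.trans (hp'.2 i)), HEq.rfl⟩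
  · intro f hf
    have hsum := (h𝓕 f).1 hf
    have hsize (i : ι) : ((f i).size.toNat : ℕ∞) = (f i).size := by
      refine ENat.natCast_toNat (ne_top_of_le_ne_top (hsum ▸ ENat.natCast_ne_top M) ?_)
      exact Finset.single_le_sum_of_canonicallyOrdered (f := fun i => (f i).size)
        (Finset.mem_univ i)
    refine ⟨⟨Finsupp.equivFunOnFinite.symm fun i => (f i).size.toNat, f⟩, ?_, rfl⟩
    simp only [Finset.mem_coe, Finset.mem_sigma, Fintype.mem_piFinset, mem_treesOfSize,
      Finset.mem_finsuppAntidiag, Finset.subset_univ, and_true]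
    refine ⟨?_, fun i => (hsize i).symm⟩
    rw [← Nat.cast_inj (R := ℕ∞), ← hsum]
    simp [hsize]

theorem weightedSeries_eq_of_graft {T₀ : PlaneTree} {s : ℕ} {W w : PlaneTree → ℝ}
    (hW : ∀ f, W (graft T₀ s f) = ∏ v, w (f v)) (hW0 : ∀ T ∉ cylinder T₀ (s + 1), W T = 0) :
    weightedSeries W =
      X ^ T₀.coreSize s * weightedSeries w ^ Fintype.card (T₀.level (s + 1)) := by
  have hrange (T : PlaneTree) (hT : T ∉ Set.range (graft T₀ s)) : W T = 0 :=
    hW0 T fun h => hT (exists_graft_eq h)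
  ext N
  rw [coeff_X_pow_mul', coeff_weightedSeries]
  split_ifs with hN
  · obtain ⟨M, rfl⟩ := Nat.exists_eq_add_of_le hN
    rw [Nat.add_sub_cancel_left, ← Finset.sum_preimage (graft T₀ s) _
      (graft_injective T₀ s).injOn W fun T _ => hrange T, coeff_weightedSeries_pow w fun f => ?_]
    · exact Finset.sum_congr rfl fun f _ => hW f
    · rw [Finset.mem_preimage, mem_treesOfSize, size_graft, Nat.cast_add,
        (ENat.addLECancellable_natCast _).inj]
  · refine Finset.sum_eq_zero fun T hT => hrange T ?_
    rintro ⟨f, rfl⟩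
    rw [mem_treesOfSize, size_graft] at hT
    exact hN (Nat.cast_le.1 (hT ▸ le_self_add))

theorem weightedSeries_indicator_cylinder {T₀ : PlaneTree} {s : ℕ} {W w : PlaneTree → ℝ}
    (hW : ∀ f, W (graft T₀ s f) = ∏ v, w (f v)) :
    weightedSeries ((cylinder T₀ (s + 1)).indicator W) =
      X ^ T₀.coreSize s * weightedSeries w ^ Fintype.card (T₀.level (s + 1)) :=
  weightedSeries_eq_of_graft
    (fun f => (Set.indicator_of_mem (graft_mem_cylinder T₀ s f) W).trans (hW f))
    fun _ hT => Set.indicator_of_notMem hT W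

theorem one_sub_mul_weightedSeries {W w : PlaneTree → ℝ}
    (hW : ∀ K f, W (graft (star K) 1 f) = ∏ v, w (f v)) :
    (1 - weightedSeries w) * weightedSeries W = X := by
  have hstar (K : ℕ) :
      weightedSeries ((cylinder (star K) 2).indicator W) = X * weightedSeries w ^ K := by
    rw [weightedSeries_indicator_cylinder (hW K), coreSize_star, pow_one]
    exact congrArg (fun n => X * weightedSeries w ^ n) (card_level_star K)
  have hpartition : HasSum (fun K => weightedSeries ((cylinder (star K) 2).indicator W))
      (weightedSeries W) := by
    refine hasSum_weightedSeries_of_size_ne_top fun T _ => ?_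
    obtain ⟨K, hK, huniq⟩ := existsUnique_mem_cylinder_star T
    have h := hasSum_single (f := fun K => (cylinder (star K) 2).indicator W T) K
      fun K' hne => Set.indicator_of_notMem (fun h => hne (huniq K' h)) W
    rwa [Set.indicator_of_mem hK] at h
  have hw0 := constantCoeff_weightedSeries w
  simp only [hstar] at hpartition
  rw [hpartition.unique
    ((WithPiTopology.summable_pow_of_constantCoeff_eq_zero hw0).hasSum.mul_left X),
    mul_left_comm, WithPiTopology.one_sub_mul_tsum_pow_of_constantCoeff_eq_zero hw0, mul_one]

theorem one_sub_mul_treeSeries : (1 - treeSeries) * treeSeries = X :=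
  one_sub_mul_weightedSeries fun _ _ => (Finset.prod_const_one).symm

theorem indicator_height_graft (T₀ : PlaneTree) (s m : ℕ) (f : T₀.level (s + 1) → PlaneTree) :
    {T : PlaneTree | T.height ≤ (s + m : ℕ)}.indicator (1 : PlaneTree → ℝ) (graft T₀ s f) =
      ∏ v, {T : PlaneTree | T.height ≤ m}.indicator 1 (f v) := by
  classical
  simp only [Set.indicator_apply, Set.mem_ofPred_eq, Pi.one_apply, height_graft_le_iff,
    Finset.prod_ite_zero, Finset.prod_const_one, Finset.mem_univ, true_imp_iff]

theorem one_sub_mul_heightSeries_succ (m : ℕ) :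
    (1 - heightSeries m) * heightSeries (m + 1) = X :=
  one_sub_mul_weightedSeries fun K f => by
    rw [← indicator_height_graft, add_comm m]

theorem heightSeries_zero : heightSeries 0 = 0 := by
  ext N
  rw [heightSeries, coeff_weightedSeries, map_zero]
  refine Finset.sum_eq_zero fun T _ => Set.indicator_of_notMem (fun h => ?_) 1
  exact absurd (T.one_le_height.trans h) (by simp)

theorem heightSeries_mem_nonnegCoeffs (m : ℕ) : heightSeries m ∈ nonnegCoeffs :=
  weightedSeries_mem_nonnegCoeffs (Set.indicator_nonneg fun _ _ => zero_le_one)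

theorem treeSeries_mem_nonnegCoeffs : treeSeries ∈ nonnegCoeffs :=
  weightedSeries_mem_nonnegCoeffs zero_le_one

theorem heightSeries_succ_sub_mem_nonnegCoeffs (m : ℕ) :
    heightSeries (m + 1) - heightSeries m ∈ nonnegCoeffs := by
  rw [heightSeries, heightSeries, ← weightedSeries_sub]
  refine weightedSeries_mem_nonnegCoeffs (sub_nonneg.2 ?_)
  refine Set.indicator_le_indicator_of_subset (fun T (h : T.height ≤ m) => ?_)
    fun _ => zero_le_one
  exact h.trans (Nat.cast_le.2 m.le_succ)

theorem treeSeries_sub_heightSeries_mem_nonnegCoeffs (m : ℕ) :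
    treeSeries - heightSeries m ∈ nonnegCoeffs := by
  rw [treeSeries, heightSeries, ← weightedSeries_sub]
  exact weightedSeries_mem_nonnegCoeffs
    (sub_nonneg.2 (Set.indicator_le_self' fun _ _ => zero_le_one))

theorem X_pow_dvd_treeSeries_sub_heightSeries (m : ℕ) :
    X ^ (m + 1) ∣ treeSeries - heightSeries m := by
  refine X_pow_dvd_iff.2 fun N hN => ?_
  rw [treeSeries, heightSeries, ← weightedSeries_sub, coeff_weightedSeries]
  refine Finset.sum_eq_zero fun T hT => sub_eq_zero.2 (Set.indicator_of_mem ?_ _).symm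
  refine T.height_le_size.trans ?_
  rw [mem_treesOfSize.1 hT]
  exact Nat.cast_le.2 (Nat.lt_succ_iff.1 hN)

/-- The generating series by total size of the `K`-tuples of finite trees, a tuple whose largest
height is `h` being counted with weight `k ^ h`. -/
noncomputable def forestSeries (k : ℝ) (K : ℕ) : ℝ⟦X⟧ :=
  ∑' m, C (k ^ (m + 1)) * (heightSeries (m + 1) ^ K - heightSeries m ^ K)

theorem hasSum_forestSeries (k : ℝ) (K : ℕ) :
    HasSum (fun m => C (k ^ (m + 1)) * (heightSeries (m + 1) ^ K - heightSeries m ^ K))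
      (forestSeries k K) := by
  refine Summable.hasSum ((WithPiTopology.summable_iff_summable_coeff ℝ).2 fun N => ?_)
  refine summable_of_ne_finset_zero (s := Finset.range N) fun m hm => ?_
  have hdvd : X ^ (m + 1) ∣ heightSeries (m + 1) - heightSeries m := by
    have h := (X_pow_dvd_treeSeries_sub_heightSeries m).sub ((pow_dvd_pow X (m + 1).le_succ).trans
      (X_pow_dvd_treeSeries_sub_heightSeries (m + 1)))
    rwa [sub_sub_sub_cancel_left] at h
  exact X_pow_dvd_iff.1 ((hdvd.trans (sub_dvd_pow_sub_pow _ _ K)).mul_left _) N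
    (Nat.lt_succ_of_le (not_lt.1 (mt Finset.mem_range.2 hm)))

theorem hasSum_pow_height (k : ℝ) {T : PlaneTree} {s : ℕ} (hs : s < T.height) (hT : T.size ≠ ⊤) :
    HasSum (fun m : ℕ => k ^ (s + (m + 1)) *
      ({T : PlaneTree | T.height ≤ (s + (m + 1) : ℕ)}.indicator (1 : PlaneTree → ℝ) T -
        {T : PlaneTree | T.height ≤ (s + m : ℕ)}.indicator 1 T)) (k ^ T.height.toNat) := by
  classical
  obtain ⟨h, hh⟩ := ENat.ne_top_iff_exists.1 (ne_top_of_le_ne_top hT T.height_le_size)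
  obtain ⟨d, rfl⟩ := Nat.exists_eq_add_of_lt (Nat.cast_lt.1 (hh ▸ hs))
  simp only [Set.indicator_apply, Set.mem_ofPred_eq, ← hh, Nat.cast_le, ENat.toNat_natCast,
    Pi.one_apply]
  have hsum := hasSum_single (f := fun m : ℕ => k ^ (s + (m + 1)) *
    ((if s + d + 1 ≤ s + (m + 1) then 1 else 0) - if s + d + 1 ≤ s + m then (1 : ℝ) else 0)) d
    fun m hm => ?_
  · convert hsum using 1
    simp [add_assoc]
  · by_cases hlt : m < d
    · rw [if_neg (by omega), if_neg (by omega), sub_self, mul_zero]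
    · rw [if_pos (by omega), if_pos (by omega), sub_self, mul_zero]

theorem hasSum_weightedSeries_indicator_pow_height (k : ℝ) {A : Set PlaneTree} {s : ℕ}
    (hA : ∀ T ∈ A, s < T.height) :
    HasSum (fun m : ℕ => C (k ^ (s + (m + 1))) *
      (weightedSeries (A.indicator ({T : PlaneTree | T.height ≤ (s + (m + 1) : ℕ)}.indicator 1)) -
        weightedSeries (A.indicator ({T : PlaneTree | T.height ≤ (s + m : ℕ)}.indicator 1))))
      (weightedSeries (A.indicator fun T => k ^ T.height.toNat)) := by
  simp only [← weightedSeries_sub, ← weightedSeries_smul]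
  refine hasSum_weightedSeries_of_size_ne_top fun T hT => ?_
  by_cases hTA : T ∈ A
  · simp only [Pi.smul_apply, Pi.sub_apply, smul_eq_mul, Set.indicator_of_mem hTA]
    exact hasSum_pow_height k (hA T hTA) hT
  · simp only [Pi.smul_apply, Pi.sub_apply, smul_eq_mul, Set.indicator_of_notMem hTA, sub_self,
      mul_zero, hasSum_zero]

theorem weightedSeries_pow_height (k : ℝ) :
    weightedSeries (fun T => k ^ T.height.toNat) = forestSeries k 1 := by
  have h := hasSum_weightedSeries_indicator_pow_height k (A := Set.univ) (s := 0) fun T _ =>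
    zero_lt_one.trans_le T.one_le_height
  simp only [Set.indicator_univ, zero_add] at h
  refine h.unique ?_
  simpa only [heightSeries, pow_one] using hasSum_forestSeries k 1

theorem weightedSeries_indicator_cylinder_pow_height (k : ℝ) {T₀ : PlaneTree} {s : ℕ}
    (h : (T₀.level (s + 1)).Nonempty) :
    weightedSeries ((cylinder T₀ (s + 1)).indicator fun T => k ^ T.height.toNat) =
      C (k ^ s) * X ^ T₀.coreSize s * forestSeries k (Fintype.card (T₀.level (s + 1))) := by
  have hcyl (m : ℕ) : weightedSeries ((cylinder T₀ (s + 1)).indicator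
      ({T : PlaneTree | T.height ≤ (s + m : ℕ)}.indicator 1)) =
        X ^ T₀.coreSize s * heightSeries m ^ Fintype.card (T₀.level (s + 1)) :=
    weightedSeries_indicator_cylinder (indicator_height_graft T₀ s m)
  have hheight (T : PlaneTree) (hT : T ∈ cylinder T₀ (s + 1)) : s < T.height := by
    obtain ⟨v, hv⟩ := level_eq_of_mem_cylinder hT ▸ h
    exact (Nat.cast_lt.2 s.lt_succ_self).trans_le (le_iSup₂_of_le (s + 1) ⟨v, hv⟩ le_rfl)
  have hsum := hasSum_weightedSeries_indicator_pow_height k hheight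
  have hterm (m : ℕ) (F G H : ℝ⟦X⟧) : C (k ^ (s + (m + 1))) * (H * F - H * G) =
      C (k ^ s) * H * (C (k ^ (m + 1)) * (F - G)) := by
    rw [pow_add k s, map_mul]
    ring
  simp only [hcyl, hterm] at hsum
  exact hsum.unique ((hasSum_forestSeries k _).mul_left _)

theorem forestSeries_mem_nonnegCoeffs {k : ℝ} (hk : 0 ≤ k) (K : ℕ) :
    forestSeries k K ∈ nonnegCoeffs :=
  mem_nonnegCoeffs_of_hasSum (fun m => mul_mem (C_mem_nonnegCoeffs (pow_nonneg hk _))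
    (pow_sub_pow_mem_nonnegCoeffs (heightSeries_mem_nonnegCoeffs m)
      (heightSeries_mem_nonnegCoeffs (m + 1)) (heightSeries_succ_sub_mem_nonnegCoeffs m) K))
    (hasSum_forestSeries k K)

end series

section asymptotics

open PowerSeries
open scoped PowerSeries.WithPiTopology

variable {k : ℝ}

/-! ### The simple pole at the critical point -/

/-- The difference between the values at `criticalPoint k` of the generating series of all finite
trees and of those of height at most `m`. -/
noncomputable def heightGap (k : ℝ) (m : ℕ) : ℝ := (k - 1) / ((1 + k) * (k ^ (m + 1) - 1))

theorem heightGap_nonneg (hk : 1 < k) (m : ℕ) : 0 ≤ heightGap k m := by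
  have hpow : 1 ≤ k ^ (m + 1) := one_le_pow₀ hk.le
  exact div_nonneg (by linarith) (mul_nonneg (by linarith) (by linarith))

theorem heightGap_zero (hk : 1 < k) : heightGap k 0 = (1 + k)⁻¹ := by
  have h : k - 1 ≠ 0 := by linarith
  rw [heightGap, zero_add, pow_one, div_mul_cancel_right₀ h]

theorem criticalPoint_pos (hk : 1 < k) : 0 < criticalPoint k := by
  have : 0 < k := by linarith
  rw [criticalPoint]
  positivity

theorem heightGap_le_inv_pow (hk : 1 < k) (m : ℕ) : heightGap k m ≤ k⁻¹ ^ m := by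
  have hpow : 1 < k ^ (m + 1) := one_lt_pow₀ hk m.succ_ne_zero
  have hm : 1 ≤ k ^ m := one_le_pow₀ hk.le
  rw [heightGap, inv_pow, ← one_div, div_le_div_iff₀ (mul_pos (by linarith) (by linarith))
    (by linarith), pow_succ]
  nlinarith [mul_nonneg (sub_nonneg.2 hm) (sub_nonneg.2 hk.le),
    mul_nonneg (sub_nonneg.2 hm) (sq_nonneg k)]

theorem tendsto_heightGap (hk : 1 < k) : Tendsto (heightGap k) atTop (𝓝 0) :=
  squeeze_zero (heightGap_nonneg hk) (heightGap_le_inv_pow hk)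
    (tendsto_pow_atTop_nhds_zero_of_lt_one (by positivity) (inv_lt_one_of_one_lt₀ hk))

theorem heightGap_sub_heightGap_succ (hk : 1 < k) (m : ℕ) :
    heightGap k m - heightGap k (m + 1) =
      (k - 1) ^ 2 * k ^ (m + 1) / ((1 + k) * (k ^ (m + 1) - 1) * (k ^ (m + 2) - 1)) := by
  have h₁ : k ^ (m + 1) - 1 ≠ 0 := (sub_pos.2 (one_lt_pow₀ hk m.succ_ne_zero)).ne'
  have h₂ : k ^ (m + 2) - 1 ≠ 0 := (sub_pos.2 (one_lt_pow₀ hk (m + 1).succ_ne_zero)).ne'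
  have h₃ : 1 + k ≠ 0 := by linarith
  rw [heightGap, heightGap, add_assoc]
  field_simp
  ring

theorem heightGap_succ_le (hk : 1 < k) (m : ℕ) : heightGap k (m + 1) ≤ heightGap k m := by
  have h₁ : 1 < k ^ (m + 1) := one_lt_pow₀ hk m.succ_ne_zero
  have h₂ : 1 < k ^ (m + 2) := one_lt_pow₀ hk (m + 1).succ_ne_zero
  rw [← sub_nonneg, heightGap_sub_heightGap_succ hk]
  have : 0 < k := by linarith
  have := sub_pos.2 h₁
  have := sub_pos.2 h₂
  positivity

theorem tendsto_pow_mul_heightGap_sub (hk : 1 < k) :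
    Tendsto (fun m => k ^ (m + 1) * (heightGap k m - heightGap k (m + 1))) atTop
      (𝓝 ((k - 1) ^ 2 / (k * (1 + k)))) := by
  have hq : Tendsto (fun m => k⁻¹ ^ (m + 1)) atTop (𝓝 0) :=
    (tendsto_pow_atTop_nhds_zero_of_lt_one (by positivity) (inv_lt_one_of_one_lt₀ hk)).comp
      (tendsto_add_atTop_nat 1)
  have hlim := (tendsto_const_nhds (x := (k - 1) ^ 2)).div
    (((hq.const_sub 1).mul (hq.const_sub k)).const_mul (1 + k))
    (mul_ne_zero (by linarith) (by simp; linarith))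
  rw [sub_zero, sub_zero, one_mul, mul_comm (1 + k)] at hlim
  refine hlim.congr fun m => ?_
  have h₁ : k ^ (m + 1) - 1 ≠ 0 := (sub_pos.2 (one_lt_pow₀ hk m.succ_ne_zero)).ne'
  have h₂ : k * k ^ (m + 1) - 1 ≠ 0 :=
    pow_succ' k (m + 1) ▸ (sub_pos.2 (one_lt_pow₀ hk (m + 1).succ_ne_zero)).ne'
  have h₃ : k ^ (m + 1) ≠ 0 := pow_ne_zero _ (by linarith)
  have h₄ : 1 + k ≠ 0 := by linarith
  rw [Pi.div_apply, heightGap_sub_heightGap_succ hk, inv_pow, pow_succ' k (m + 1)]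
  generalize k ^ (m + 1) = q at *
  have : 1 - q⁻¹ ≠ 0 := by
    rw [show 1 - q⁻¹ = (q - 1) / q by field_simp]
    exact div_ne_zero h₁ h₃
  have : k - q⁻¹ ≠ 0 := by
    rw [show k - q⁻¹ = (k * q - 1) / q by field_simp]
    exact div_ne_zero h₂ h₃
  field_simp

theorem hasValueAt_heightSeries (hk : 1 < k) (m : ℕ) :
    HasValueAt (heightSeries m) (criticalPoint k) ((1 + k)⁻¹ - heightGap k m) := by
  induction m with
  | zero =>
    rw [heightSeries_zero, heightGap_zero hk, sub_self]
    simpa using HasValueAt.const 0 (criticalPoint k)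
  | succ m ih =>
    have hlt : (1 + k)⁻¹ < 1 := inv_lt_one_of_one_lt₀ (by linarith)
    have hvalue := HasValueAt.of_one_sub_mul_eq (criticalPoint_pos hk).le
      (heightSeries_mem_nonnegCoeffs m) X_mem_nonnegCoeffs (constantCoeff_weightedSeries _)
      (one_sub_mul_heightSeries_succ m) ih ((sub_le_self _ (heightGap_nonneg hk m)).trans_lt hlt)
      (HasValueAt.var _)
    convert hvalue using 1
    have h₁ : k ^ (m + 1) - 1 ≠ 0 := (sub_pos.2 (one_lt_pow₀ hk m.succ_ne_zero)).ne'
    have h₂ : k ^ (m + 2) - 1 ≠ 0 := (sub_pos.2 (one_lt_pow₀ hk (m + 1).succ_ne_zero)).ne'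
    have h₃ : 1 + k ≠ 0 := by linarith
    have hdenom : 1 - ((1 + k)⁻¹ - heightGap k m) =
        (k ^ (m + 2) - 1) / ((1 + k) * (k ^ (m + 1) - 1)) := by
      rw [heightGap]
      field_simp
      ring
    rw [hdenom, heightGap, criticalPoint, add_assoc, one_add_one_eq_two]
    field_simp
    ring

theorem hasSum_heightGap_sub (hk : 1 < k) :
    HasSum (fun m => heightGap k m - heightGap k (m + 1)) (1 + k)⁻¹ := by
  refine (hasSum_iff_tendsto_nat_of_nonneg
    (fun m => sub_nonneg.2 (heightGap_succ_le hk m)) _).2 ?_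
  simpa only [Finset.sum_range_sub', heightGap_zero hk, sub_zero] using
    (tendsto_heightGap hk).const_sub (heightGap k 0)

theorem hasValueAt_heightSeries_succ_sub (hk : 1 < k) (m : ℕ) :
    HasValueAt (heightSeries (m + 1) - heightSeries m) (criticalPoint k)
      (heightGap k m - heightGap k (m + 1)) := by
  simpa only [sub_sub_sub_cancel_left] using
    (hasValueAt_heightSeries hk (m + 1)).sub (hasValueAt_heightSeries hk m)

theorem forestSeries_one_one : forestSeries 1 1 = treeSeries := by
  rw [← weightedSeries_pow_height, treeSeries]
  simp only [one_pow, Pi.one_def]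

theorem hasValueAt_treeSeries (hk : 1 < k) :
    HasValueAt treeSeries (criticalPoint k) (1 + k)⁻¹ := by
  have hsum := hasSum_forestSeries 1 1
  simp only [one_pow, map_one, one_mul, pow_one, forestSeries_one_one] at hsum
  exact .of_hasSum (criticalPoint_pos hk).le heightSeries_succ_sub_mem_nonnegCoeffs
    (hasValueAt_heightSeries_succ_sub hk) hsum (hasSum_heightGap_sub hk)

theorem one_sub_heightSeries_succ_mul (m : ℕ) :
    (1 - heightSeries (m + 1)) * (heightSeries (m + 2) - heightSeries (m + 1)) =
      heightSeries (m + 1) * (heightSeries (m + 1) - heightSeries m) := by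
  linear_combination one_sub_mul_heightSeries_succ (m + 1) - one_sub_mul_heightSeries_succ m

theorem treeSeries_mul_sub_one_sub_mul (m : ℕ) :
    treeSeries * (heightSeries (m + 1) - heightSeries m) -
        (1 - treeSeries) * (heightSeries (m + 2) - heightSeries (m + 1)) =
      (treeSeries - heightSeries (m + 1)) * (heightSeries (m + 2) - heightSeries m) := by
  linear_combination -one_sub_heightSeries_succ_mul m

theorem hasSum_pow_mul_heightSeries_defect (k : ℝ) :
    HasSum (fun m => C (k ^ (m + 2)) *
        ((treeSeries - heightSeries (m + 1)) * (heightSeries (m + 2) - heightSeries m)))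
      (C k * (1 - treeSeries) * X - (1 - (1 + C k) * treeSeries) * forestSeries k 1) := by
  have hsum := hasSum_forestSeries k 1
  simp only [pow_one] at hsum
  have htail := (hasSum_nat_add_iff' 1).2 hsum
  have hone : heightSeries 1 = X := by
    simpa [heightSeries_zero] using one_sub_mul_heightSeries_succ 0
  simp only [Finset.sum_range_one, zero_add, pow_one, hone, heightSeries_zero, sub_zero,
    add_assoc, one_add_one_eq_two] at htail
  have hdefect := (hsum.mul_left (C k * treeSeries)).sub (htail.mul_left (1 - treeSeries))
  rw [show C k * (1 - treeSeries) * X - (1 - (1 + C k) * treeSeries) * forestSeries k 1 =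
    C k * treeSeries * forestSeries k 1 - (1 - treeSeries) * (forestSeries k 1 - C k * X) by ring]
  have hterm (m : ℕ) : C (k ^ (m + 2)) *
      ((treeSeries - heightSeries (m + 1)) * (heightSeries (m + 2) - heightSeries m)) =
      C k * treeSeries * (C (k ^ (m + 1)) * (heightSeries (m + 1) - heightSeries m)) -
        (1 - treeSeries) * (C (k ^ (m + 2)) * (heightSeries (m + 2) - heightSeries (m + 1))) := by
    rw [← treeSeries_mul_sub_one_sub_mul, pow_succ' k (m + 1), map_mul]
    ring
  simpa only [hterm] using hdefect

theorem hasValueAt_heightSeries_defect (hk : 1 < k) :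
    HasValueAt (C k * (1 - treeSeries) * X - (1 - (1 + C k) * treeSeries) * forestSeries k 1)
      (criticalPoint k) ((1 + k)⁻¹ * (k ^ 2 * criticalPoint k - (k - 1) ^ 2 / (1 + k))) := by
  have hx := (criticalPoint_pos hk).le
  have hk0 : k ≠ 0 := by linarith
  have hk1 : 1 + k ≠ 0 := by linarith
  set gap : ℕ → ℝ := fun m => k ^ (m + 2) * (heightGap k m - heightGap k (m + 1)) with hgap
  have hmem (m : ℕ) : C (k ^ (m + 2)) * ((treeSeries - heightSeries (m + 1)) *
      (heightSeries (m + 2) - heightSeries m)) ∈ nonnegCoeffs := by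
    refine mul_mem (C_mem_nonnegCoeffs (by positivity))
      (mul_mem (treeSeries_sub_heightSeries_mem_nonnegCoeffs _) ?_)
    rw [← sub_add_sub_cancel _ (heightSeries (m + 1))]
    exact add_mem (heightSeries_succ_sub_mem_nonnegCoeffs _)
      (heightSeries_succ_sub_mem_nonnegCoeffs _)
  have hvalue (m : ℕ) : HasValueAt (C (k ^ (m + 2)) * ((treeSeries - heightSeries (m + 1)) *
      (heightSeries (m + 2) - heightSeries m))) (criticalPoint k)
      ((1 + k)⁻¹ * (gap m - gap (m + 1))) := by
    rw [← treeSeries_mul_sub_one_sub_mul]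
    convert (HasValueAt.const (k ^ (m + 2)) _).mul
      (((hasValueAt_treeSeries hk).mul (hasValueAt_heightSeries_succ_sub hk m)).sub
        (((HasValueAt.const 1 _).sub (hasValueAt_treeSeries hk)).mul
          (hasValueAt_heightSeries_succ_sub hk (m + 1)))) using 1
    · rw [map_one]
    · simp only [hgap]
      field_simp
      ring
  refine .of_hasSum hx hmem hvalue (hasSum_pow_mul_heightSeries_defect k)
    ((hasSum_iff_tendsto_nat_of_nonneg (fun m => (hvalue m).nonneg hx (hmem m)) _).2 ?_)
  have hzero : gap 0 = k ^ 2 * criticalPoint k := by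
    have h : k - 1 ≠ 0 := by linarith
    simp only [hgap, heightGap_sub_heightGap_succ hk, criticalPoint, zero_add, pow_one]
    rw [show k ^ 2 - 1 = (k - 1) * (1 + k) by ring]
    field_simp
  have hlim : Tendsto gap atTop (𝓝 ((k - 1) ^ 2 / (1 + k))) := by
    convert (tendsto_pow_mul_heightGap_sub hk).const_mul k using 2
    · rw [hgap]
      ring
    · field_simp
  simp_rw [← Finset.mul_sum, Finset.sum_range_sub', hzero]
  exact (hlim.const_sub _).const_mul _

/-- The residue of `forestSeries k 1` at `criticalPoint k`, in the sense of `HasResidueAt`. -/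
noncomputable def forestResidue (k : ℝ) : ℝ := (k - 1) ^ 3 / (1 + k) ^ 4

theorem forestResidue_pos (hk : 1 < k) : 0 < forestResidue k :=
  div_pos (pow_pos (by linarith) 3) (pow_pos (by linarith) 4)

theorem hasResidueAt_forestSeries_one (hk : 1 < k) :
    HasResidueAt (forestSeries k 1) (criticalPoint k) (forestResidue k) := by
  have hk1 : 1 + k ≠ 0 := by linarith
  have hT := hasValueAt_treeSeries hk
  have hvalue := ((HasValueAt.const ((1 + k)⁻¹) _).mul
    ((HasValueAt.const (1 - (1 + k)⁻¹) _).sub hT)).mul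
    ((((HasValueAt.const k _).mul ((HasValueAt.const 1 _).sub hT)).mul (HasValueAt.var _)).sub
      (hasValueAt_heightSeries_defect hk))
  rw [HasResidueAt]
  convert hvalue using 1
  · have hg : criticalPoint k = (1 + k)⁻¹ * (1 - (1 + k)⁻¹) := by
      rw [criticalPoint]
      field_simp
      ring
    have hinv : C ((1 + k)⁻¹) * (1 + C k) = 1 := by
      rw [← map_one C, ← map_add, ← map_mul, inv_mul_cancel₀ hk1]
    rw [hg, map_mul, map_sub, map_one]
    linear_combination forestSeries k 1 * one_sub_mul_treeSeries +
      (1 - C ((1 + k)⁻¹) - treeSeries) * treeSeries * forestSeries k 1 * hinv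
  · rw [forestResidue, criticalPoint]
    field_simp
    ring

theorem hasSum_forestSeries_defect (k : ℝ) (K : ℕ) :
    HasSum (fun m => C (k ^ (m + 1)) *
        ((treeSeries - heightSeries (m + 1)) * (heightSeries (m + 1) ^ K - heightSeries m ^ K) +
          (treeSeries ^ K - heightSeries m ^ K) * (heightSeries (m + 1) - heightSeries m)))
      (treeSeries * forestSeries k K + treeSeries ^ K * forestSeries k 1 -
        forestSeries k (K + 1)) := by
  have hsum := (((hasSum_forestSeries k K).mul_left treeSeries).add
    ((hasSum_forestSeries k 1).mul_left (treeSeries ^ K))).sub (hasSum_forestSeries k (K + 1))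
  have hterm (m : ℕ) : C (k ^ (m + 1)) *
      ((treeSeries - heightSeries (m + 1)) * (heightSeries (m + 1) ^ K - heightSeries m ^ K) +
        (treeSeries ^ K - heightSeries m ^ K) * (heightSeries (m + 1) - heightSeries m)) =
      treeSeries * (C (k ^ (m + 1)) * (heightSeries (m + 1) ^ K - heightSeries m ^ K)) +
        treeSeries ^ K * (C (k ^ (m + 1)) * (heightSeries (m + 1) ^ 1 - heightSeries m ^ 1)) -
        C (k ^ (m + 1)) * (heightSeries (m + 1) ^ (K + 1) - heightSeries m ^ (K + 1)) := by
    ring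
  simpa only [hterm] using hsum

theorem forestSeries_defect_term_mem_nonnegCoeffs (hk : 0 ≤ k) (K m : ℕ) :
    C (k ^ (m + 1)) *
      ((treeSeries - heightSeries (m + 1)) * (heightSeries (m + 1) ^ K - heightSeries m ^ K) +
        (treeSeries ^ K - heightSeries m ^ K) * (heightSeries (m + 1) - heightSeries m)) ∈
      nonnegCoeffs := by
  have hle := heightSeries_succ_sub_mem_nonnegCoeffs m
  exact mul_mem (C_mem_nonnegCoeffs (by positivity)) (add_mem
    (mul_mem (treeSeries_sub_heightSeries_mem_nonnegCoeffs _) (pow_sub_pow_mem_nonnegCoeffs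
      (heightSeries_mem_nonnegCoeffs _) (heightSeries_mem_nonnegCoeffs _) hle _))
    (mul_mem (pow_sub_pow_mem_nonnegCoeffs (heightSeries_mem_nonnegCoeffs _)
      treeSeries_mem_nonnegCoeffs (treeSeries_sub_heightSeries_mem_nonnegCoeffs _) _) hle))

theorem pow_sub_pow_le_mul_sub {a b : ℝ} (hb : 0 ≤ b) (hab : b ≤ a) (ha : a ≤ 1) (n : ℕ) :
    a ^ n - b ^ n ≤ n * (a - b) := by
  have hmax : max |a| |b| ≤ 1 := by
    rw [abs_of_nonneg hb, abs_of_nonneg (hb.trans hab), max_eq_left hab]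
    exact ha
  calc a ^ n - b ^ n ≤ |a ^ n - b ^ n| := le_abs_self _
    _ ≤ |a - b| * n * max |a| |b| ^ (n - 1) := abs_pow_sub_pow_le ..
    _ ≤ |a - b| * n * 1 := by
        gcongr
        exact pow_le_one₀ (le_max_of_le_left (abs_nonneg a)) hmax
    _ = n * (a - b) := by rw [abs_of_nonneg (sub_nonneg.2 hab), mul_one, mul_comm]

theorem forestSeries_defect_value_le (hk : 1 < k) (K m : ℕ) :
    k ^ (m + 1) * (((1 + k)⁻¹ - ((1 + k)⁻¹ - heightGap k (m + 1))) *
        (((1 + k)⁻¹ - heightGap k (m + 1)) ^ K - ((1 + k)⁻¹ - heightGap k m) ^ K) +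
      ((1 + k)⁻¹ ^ K - ((1 + k)⁻¹ - heightGap k m) ^ K) *
        (heightGap k m - heightGap k (m + 1))) ≤ 2 * K * k * k⁻¹ ^ m := by
  have hle := heightGap_succ_le hk m
  have hd₁ := heightGap_nonneg hk (m + 1)
  have hd := heightGap_nonneg hk m
  have hu : (1 + k)⁻¹ ≤ 1 := inv_le_one_of_one_le₀ (by linarith)
  have hβ : 0 ≤ (1 + k)⁻¹ - heightGap k m :=
    (hasValueAt_heightSeries hk m).nonneg (criticalPoint_pos hk).le
      (heightSeries_mem_nonnegCoeffs m)
  have hα := pow_sub_pow_le_mul_sub hβ (a := (1 + k)⁻¹ - heightGap k (m + 1)) (by linarith)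
    (by linarith) K
  have hT := pow_sub_pow_le_mul_sub hβ (a := (1 + k)⁻¹) (by linarith) hu K
  have : (0 : ℝ) ≤ K := K.cast_nonneg
  calc _ ≤ k ^ (m + 1) * (heightGap k m * (K * heightGap k m) +
          K * heightGap k m * heightGap k m) := by
        gcongr
        · exact sub_nonneg.2 (pow_le_pow_left₀ hβ (by linarith) K)
        · linarith
        · nlinarith
        · linarith
        · linarith
    _ ≤ k ^ (m + 1) * (k⁻¹ ^ m * (K * k⁻¹ ^ m) + K * k⁻¹ ^ m * k⁻¹ ^ m) := by
        gcongr <;> exact heightGap_le_inv_pow hk m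
    _ = 2 * K * k * k⁻¹ ^ m := by
        rw [inv_pow]
        field_simp
        ring

theorem exists_hasValueAt_forestSeries_defect (hk : 1 < k) (K : ℕ) :
    treeSeries * forestSeries k K + treeSeries ^ K * forestSeries k 1 - forestSeries k (K + 1) ∈
        nonnegCoeffs ∧
      ∃ c, HasValueAt
        (treeSeries * forestSeries k K + treeSeries ^ K * forestSeries k 1 - forestSeries k (K + 1))
        (criticalPoint k) c := by
  have hx := (criticalPoint_pos hk).le
  have hsum := hasSum_forestSeries_defect k K
  have hmem (m : ℕ) := forestSeries_defect_term_mem_nonnegCoeffs (zero_le_one.trans hk.le) K m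
  have hT := hasValueAt_treeSeries hk
  have hX (m : ℕ) := hasValueAt_heightSeries hk m
  have hvalue (m : ℕ) := (HasValueAt.const (k ^ (m + 1)) (criticalPoint k)).mul
    (((hT.sub (hX (m + 1))).mul (((hX (m + 1)).pow K).sub ((hX m).pow K))).add
      (((hT.pow K).sub ((hX m).pow K)).mul (hasValueAt_heightSeries_succ_sub hk m)))
  have hsummable := Summable.of_nonneg_of_le (fun m => (hvalue m).nonneg hx (hmem m))
    (forestSeries_defect_value_le hk K)
    ((summable_geometric_of_lt_one (by positivity) (inv_lt_one_of_one_lt₀ hk)).mul_left _)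
  exact ⟨mem_nonnegCoeffs_of_hasSum hmem hsum, _, .of_hasSum hx hmem hvalue hsum hsummable.hasSum⟩

theorem exists_hasValueAt_mul_pow_mul_sub_forestSeries (hk : 1 < k) (j : ℕ) :
    C (j + 1 : ℝ) * treeSeries ^ j * forestSeries k 1 - forestSeries k (j + 1) ∈ nonnegCoeffs ∧
      ∃ c, HasValueAt
        (C (j + 1 : ℝ) * treeSeries ^ j * forestSeries k 1 - forestSeries k (j + 1))
        (criticalPoint k) c := by
  induction j with
  | zero =>
    rw [Nat.cast_zero, zero_add, map_one, pow_zero, one_mul, one_mul, zero_add, sub_self]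
    exact ⟨zero_mem _, 0, by simpa using HasValueAt.const 0 (criticalPoint k)⟩
  | succ j ih =>
    obtain ⟨hmem, c, hc⟩ := ih
    obtain ⟨hmem', c', hc'⟩ := exists_hasValueAt_forestSeries_defect hk (j + 1)
    have hrec : C ((j + 1 : ℕ) + 1 : ℝ) * treeSeries ^ (j + 1) * forestSeries k 1 -
        forestSeries k (j + 1 + 1) =
        treeSeries * (C (j + 1 : ℝ) * treeSeries ^ j * forestSeries k 1 - forestSeries k (j + 1)) +
          (treeSeries * forestSeries k (j + 1) + treeSeries ^ (j + 1) * forestSeries k 1 -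
            forestSeries k (j + 1 + 1)) := by
      rw [Nat.cast_succ, map_add C (j + 1 : ℝ), map_one]
      ring
    rw [hrec]
    exact ⟨add_mem (mul_mem treeSeries_mem_nonnegCoeffs hmem) hmem', _,
      ((hasValueAt_treeSeries hk).mul hc).add hc'⟩

theorem hasResidueAt_forestSeries (hk : 1 < k) (j : ℕ) :
    HasResidueAt (forestSeries k (j + 1)) (criticalPoint k)
      ((j + 1) * (1 + k)⁻¹ ^ j * forestResidue k) := by
  obtain ⟨-, c, hc⟩ := exists_hasValueAt_mul_pow_mul_sub_forestSeries hk j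
  have hfactor := (HasValueAt.const (j + 1 : ℝ) _).mul ((hasValueAt_treeSeries hk).pow j)
  have h := (hfactor.mul_hasResidueAt (hasResidueAt_forestSeries_one hk)).sub hc.hasResidueAt_zero
  rwa [sub_sub_cancel, sub_zero] at h

end asymptotics

section cylinderSeries

open PowerSeries
open scoped PowerSeries.WithPiTopology

variable {k : ℝ}

/-! ### The weights of cylinders -/

/-- The generating series by size of the trees in the cylinder of radius `s + 1` around `T₀`, a tree
of height `h` carrying the weight `k ^ h`. -/
noncomputable def cylinderSeries (k : ℝ) (T₀ : PlaneTree) (s : ℕ) : ℝ⟦X⟧ :=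
  weightedSeries ((cylinder T₀ (s + 1)).indicator fun T => k ^ T.height.toNat)

/-- The limiting probability of the cylinder of radius `s + 1` around `T`. It vanishes if `T` has
height at most `s`. -/
noncomputable def limitWeight (k : ℝ) (T : PlaneTree) (s : ℕ) : ℝ :=
  k ^ s * criticalPoint k ^ T.coreSize s *
    (Fintype.card (T.level (s + 1)) * (1 + k)⁻¹ ^ (Fintype.card (T.level (s + 1)) - 1))

theorem limitWeight_nonneg (hk : 1 < k) (T : PlaneTree) (s : ℕ) : 0 ≤ limitWeight k T s := by
  have := (criticalPoint_pos hk).le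
  rw [limitWeight]
  positivity

theorem card_level_pos {T : PlaneTree} {r : ℕ} (h : (T.level r).Nonempty) :
    0 < Fintype.card (T.level r) :=
  Fintype.card_pos_iff.2 h.to_subtype

theorem limitWeight_of_level_eq_empty (k : ℝ) {T : PlaneTree} {s : ℕ} (h : T.level (s + 1) = ∅) :
    limitWeight k T s = 0 := by
  have := Set.isEmpty_coe_sort.2 h
  rw [limitWeight, Fintype.card_eq_zero, Nat.cast_zero, zero_mul, mul_zero]

theorem hasValueAt_limitWeight (hk : 1 < k) {T : PlaneTree} {s j : ℕ}
    (hj : Fintype.card (T.level (s + 1)) = j + 1) :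
    HasValueAt (C (k ^ s) * X ^ T.coreSize s * (C (j + 1 : ℝ) * treeSeries ^ j)) (criticalPoint k)
      (limitWeight k T s) := by
  rw [limitWeight, hj, Nat.add_sub_cancel, Nat.cast_succ]
  exact ((HasValueAt.const _ _).mul ((HasValueAt.var _).pow _)).mul
    ((HasValueAt.const _ _).mul ((hasValueAt_treeSeries hk).pow j))

theorem trunc_eq_self_of_level_eq_empty {T : PlaneTree} {s : ℕ} (h : T.level (s + 1) = ∅) :
    T.trunc s = T := by
  have hmem := T.trunc_mem_cylinder s
  rwa [cylinder_eq_singleton h] at hmem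

theorem cylinderSeries_of_level_eq_empty (k : ℝ) {T : PlaneTree} {s : ℕ}
    (h : T.level (s + 1) = ∅) :
    cylinderSeries k T s = C (k ^ T.height.toNat) * X ^ T.size.toNat := by
  have hsize : T.size ≠ ⊤ := trunc_eq_self_of_level_eq_empty h ▸ T.size_trunc_ne_top s
  have hsum := hasSum_C_mul_X_pow_size (Set.indicator {T} fun T => k ^ T.height.toNat)
  rw [cylinderSeries, cylinder_eq_singleton h, ← hsum.tsum_eq,
    tsum_eq_single (⟨T, hsize⟩ : {T : PlaneTree // T.size ≠ ⊤}) fun S hS => ?_,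
    Set.indicator_of_mem (Set.mem_singleton T)]
  have hST : S.1 ∉ ({T} : Set PlaneTree) := fun hST => hS (Subtype.ext hST)
  rw [Set.indicator_of_notMem hST, map_zero, zero_mul]

theorem hasResidueAt_cylinderSeries (hk : 1 < k) (T : PlaneTree) (s : ℕ) :
    HasResidueAt (cylinderSeries k T s) (criticalPoint k)
      (limitWeight k T s * forestResidue k) := by
  obtain h | h := (T.level (s + 1)).eq_empty_or_nonempty
  · rw [cylinderSeries_of_level_eq_empty k h, limitWeight_of_level_eq_empty k h, zero_mul]
    exact ((HasValueAt.const _ _).mul ((HasValueAt.var _).pow _)).hasResidueAt_zero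
  · obtain ⟨j, hj⟩ := Nat.exists_eq_add_one.2 (card_level_pos h)
    rw [cylinderSeries, weightedSeries_indicator_cylinder_pow_height k h, limitWeight, hj,
      Nat.add_sub_cancel, Nat.cast_succ, mul_assoc _ (_ * _)]
    exact ((HasValueAt.const _ _).mul ((HasValueAt.var _).pow _)).mul_hasResidueAt
      (hasResidueAt_forestSeries hk j)

theorem coeff_cylinderSeries_of_nonempty_le (hk : 1 < k) {T : PlaneTree} {s : ℕ}
    (h : (T.level (s + 1)).Nonempty) {M : ℝ}
    (hM : ∀ n, coeff n (forestSeries k 1) * criticalPoint k ^ (n + 1) ≤ M) (n : ℕ) :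
    coeff n (cylinderSeries k T s) * criticalPoint k ^ (n + 1) ≤ limitWeight k T s * M := by
  have hx := (criticalPoint_pos hk).le
  have hk0 : 0 ≤ k := zero_le_one.trans hk.le
  have hM0 : 0 ≤ M :=
    (mul_nonneg (forestSeries_mem_nonnegCoeffs hk0 1 0) (pow_nonneg hx _)).trans (hM 0)
  obtain ⟨j, hj⟩ := Nat.exists_eq_add_one.2 (card_level_pos h)
  set P : ℝ⟦X⟧ := C (k ^ s) * X ^ T.coreSize s
  set Q : ℝ⟦X⟧ := C (j + 1 : ℝ) * treeSeries ^ j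
  have hP0 : P ∈ nonnegCoeffs :=
    mul_mem (C_mem_nonnegCoeffs (pow_nonneg hk0 s)) (pow_mem X_mem_nonnegCoeffs _)
  have hQ0 : Q ∈ nonnegCoeffs :=
    mul_mem (C_mem_nonnegCoeffs (by positivity)) (pow_mem treeSeries_mem_nonnegCoeffs j)
  have hdom : 0 ≤ coeff n (P * (Q * forestSeries k 1 - forestSeries k (j + 1))) :=
    mul_mem hP0 (exists_hasValueAt_mul_pow_mul_sub_forestSeries hk j).1 n
  rw [mul_sub, ← mul_assoc, map_sub, sub_nonneg] at hdom
  rw [cylinderSeries, weightedSeries_indicator_cylinder_pow_height k h, hj]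
  exact (mul_le_mul_of_nonneg_right hdom (pow_nonneg hx _)).trans
    ((hasValueAt_limitWeight hk hj).coeff_mul_le hx (mul_mem hP0 hQ0) hM0 hM n)

theorem coeff_cylinderSeries_of_level_eq_empty_le (hk : 1 < k) {T : PlaneTree} {s : ℕ}
    (h : T.level (s + 1) = ∅) (n : ℕ) :
    coeff n (cylinderSeries k T s) * criticalPoint k ^ (n + 1) ≤
      k ^ s * criticalPoint k ^ (T.size.toNat + 1) := by
  have hx := (criticalPoint_pos hk).le
  have hheight : T.height.toNat ≤ s :=
    ENat.toNat_le_of_le_natCast (height_le_of_level_succ_eq_empty h)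
  rw [cylinderSeries_of_level_eq_empty k h, coeff_C_mul, coeff_X_pow]
  split_ifs with hn
  · rw [mul_one, hn]
    gcongr
    exact hk.le
  · rw [mul_zero, zero_mul]
    positivity

theorem coeff_cylinderSeries_le (hk : 1 < k) {M : ℝ}
    (hM : ∀ n, coeff n (forestSeries k 1) * criticalPoint k ^ (n + 1) ≤ M) (T : PlaneTree)
    (s n : ℕ) : coeff n (cylinderSeries k T s) * criticalPoint k ^ (n + 1) ≤
      limitWeight k T s * M + k ^ s * criticalPoint k ^ (T.size.toNat + 1) := by
  obtain h | h := (T.level (s + 1)).eq_empty_or_nonempty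
  · rw [limitWeight_of_level_eq_empty k h, zero_mul, zero_add]
    exact coeff_cylinderSeries_of_level_eq_empty_le hk h n
  · have hx := (criticalPoint_pos hk).le
    exact (coeff_cylinderSeries_of_nonempty_le hk h hM n).trans
      (le_add_of_nonneg_right (by positivity))

theorem coeff_forestSeries_one_pos (hk : 0 < k) (N : ℕ) : 0 < coeff (N + 1) (forestSeries k 1) := by
  rw [← weightedSeries_pow_height, coeff_weightedSeries]
  exact Finset.sum_pos (fun T _ => pow_pos hk _) (nonempty_treesOfSize N)

end cylinderSeries

/-! ### Topology and Borel sets -/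

theorem nhds_hasBasis_cylinder (T : PlaneTree) :
    (𝓝 T).HasBasis (fun _ => True) fun s : ℕ => cylinder T (s + 1) := by
  simpa only [← Nat.cast_succ, closedBall_eq_cylinder T (Nat.succ_pos _)] using
    Metric.nhds_basis_closedBall_inv_nat_succ (x := T)

theorem isClopen_cylinder (T : PlaneTree) (s : ℕ) : IsClopen (cylinder T (s + 1)) := by
  refine ⟨?_, isOpen_iff_mem_nhds.2 fun S hS => ?_⟩
  · rw [← closedBall_eq_cylinder T s.succ_pos]
    exact Metric.isClosed_closedBall
  · rw [← cylinder_eq_of_mem hS]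
    exact (nhds_hasBasis_cylinder S).mem_of_mem trivial

theorem measurableSet_cylinder (T : PlaneTree) (s : ℕ) : MeasurableSet (cylinder T (s + 1)) :=
  (isClopen_cylinder T s).isOpen.measurableSet

theorem isTopologicalBasis_cylinder :
    TopologicalSpace.IsTopologicalBasis {A | ∃ T s, A = cylinder T (s + 1)} := by
  refine TopologicalSpace.isTopologicalBasis_of_isOpen_of_nhds ?_ fun T U hT hU => ?_
  · rintro _ ⟨T, s, rfl⟩
    exact (isClopen_cylinder T s).isOpen
  · obtain ⟨s, -, hs⟩ := (nhds_hasBasis_cylinder T).mem_iff.1 (hU.mem_nhds hT)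
    exact ⟨_, ⟨T, s, rfl⟩, mem_cylinder_self T _, hs⟩

theorem exists_eventually_mem_cylinder {l : Filter PlaneTree} [l.NeBot] {b : ℕ → PlaneTree}
    (h : ∀ s, ∀ᶠ T in l, T ∈ cylinder (b s) (s + 1)) :
    ∃ T₀, ∀ s, ∀ᶠ T in l, T ∈ cylinder T₀ (s + 1) := by
  have hmem (v : List ℕ) {s : ℕ} (hv : v.length ≤ s + 1) :
      (∀ᶠ T in l, v ∈ T.verts) ↔ v ∈ (b s).verts :=
    (eventually_congr ((h s).mono fun T hT => iff_of_eq <| propext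
      (mem_verts_iff_of_mem_cylinder hT hv))).trans eventually_const
  let T₀ : PlaneTree :=
    { verts := {v | ∀ᶠ T in l, v ∈ T.verts}
      root_mem := Eventually.of_forall root_mem
      parent_mem := fun v i hv => hv.mono fun T => T.parent_mem v i
      offspring := fun v hv => by
        obtain ⟨n, hn⟩ := (b v.length).offspring v ((hmem v v.length.le_succ).1 hv)
        exact ⟨n, fun i => (hmem (v ++ [i]) (by simp)).trans (hn i)⟩
      root_edge := fun i => by
        rw [Set.mem_ofPred_eq, hmem [i] (s := 0) le_rfl, (b 0).root_edge i] }
  refine ⟨T₀, fun s => (h s).mono fun T hT => ?_⟩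
  rwa [cylinder_eq_of_mem (rootBall_eq_iff.2 fun v hv => hmem v hv : T₀ ∈ cylinder (b s) (s + 1))]

theorem isCompact_setOf_trunc_mem {F : ℕ → Set PlaneTree} (hF : ∀ s, (F s).Finite) :
    IsCompact {T : PlaneTree | ∀ s, T.trunc s ∈ F s} := by
  refine isCompact_iff_ultrafilter_le_nhds.2 fun U hU => ?_
  have htrunc (s : ℕ) : ∀ᶠ T in (U : Filter PlaneTree), T.trunc s ∈ F s :=
    mem_of_superset (le_principal_iff.1 hU) fun T hT => hT s
  have hb (s : ℕ) : ∃ b ∈ F s, ∀ᶠ T in (U : Filter PlaneTree), T.trunc s = b :=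
    (Ultrafilter.finite_biUnion_mem_iff (hF s)).1
      (mem_of_superset (htrunc s) fun T hT => Set.mem_biUnion hT rfl)
  choose b _ hb using hb
  obtain ⟨T₀, hT₀⟩ := exists_eventually_mem_cylinder (b := b) fun s =>
    (hb s).mono fun T hT => hT ▸ cylinder_trunc T s ▸ mem_cylinder_self T _
  refine ⟨T₀, fun s => ?_, (nhds_hasBasis_cylinder T₀).ge_iff.2 fun s _ => hT₀ s⟩
  obtain ⟨T, hT, hTs⟩ := ((hT₀ s).and (htrunc s)).exists
  rwa [← trunc_eq_trunc_iff.2 hT]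

theorem countable_setOf_eq_cylinder : {A | ∃ T s, A = cylinder T (s + 1)}.Countable := by
  refine (Set.countable_iUnion fun s => countable_setOf_size_ne_top.image
    fun T => cylinder T (s + 1)).mono ?_
  rintro _ ⟨T, s, rfl⟩
  exact Set.mem_iUnion.2 ⟨s, T.trunc s, T.size_trunc_ne_top s, T.cylinder_trunc s⟩

/-- The cylinders around trees that reach the radius of the cylinder: the only ones whose measure is
prescribed by the ball formula. -/
def tallCylinders : Set (Set PlaneTree) :=
  {A | ∃ T s, (T.level (s + 1)).Nonempty ∧ A = cylinder T (s + 1)}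

theorem isPiSystem_tallCylinders : IsPiSystem tallCylinders := by
  rintro _ ⟨T, s, hT, rfl⟩ _ ⟨T', t, hT', rfl⟩ ⟨S, hS, hS'⟩
  rw [← cylinder_eq_of_mem hS, ← cylinder_eq_of_mem hS']
  rw [← level_eq_of_mem_cylinder hS] at hT
  rw [← level_eq_of_mem_cylinder hS'] at hT'
  obtain hst | hts := le_total s t
  · rw [Set.inter_eq_right.2 (S.cylinder_anti (Nat.succ_le_succ hst))]
    exact ⟨S, t, hT', rfl⟩
  · rw [Set.inter_eq_left.2 (S.cylinder_anti (Nat.succ_le_succ hts))]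
    exact ⟨S, s, hT, rfl⟩

theorem measurableSet_generateFrom_setOf_nonempty_level (s : ℕ) :
    MeasurableSet[.generateFrom tallCylinders] {T : PlaneTree | (T.level (s + 1)).Nonempty} := by
  have hunion : {T : PlaneTree | (T.level (s + 1)).Nonempty} =
      ⋃ T ∈ {T : PlaneTree | T.size ≠ ⊤ ∧ (T.level (s + 1)).Nonempty}, cylinder T (s + 1) := by
    ext S
    simp only [Set.mem_iUnion₂]
    refine ⟨fun hS => ⟨S.trunc s, ⟨S.size_trunc_ne_top s, ?_⟩, ?_⟩, ?_⟩
    · rwa [level_eq_of_mem_cylinder (S.trunc_mem_cylinder s)]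
    · exact S.cylinder_trunc s ▸ mem_cylinder_self S _
    · rintro ⟨T, ⟨-, hT⟩, hS⟩
      rwa [Set.mem_ofPred_eq, level_eq_of_mem_cylinder hS]
  rw [hunion]
  exact .biUnion (countable_setOf_size_ne_top.mono fun T hT => hT.1) fun T hT =>
    .basic _ ⟨T, s, hT.2, rfl⟩

theorem cylinder_succ_eq_sdiff {T : PlaneTree} {r : ℕ} (h : T.level (r + 1) = ∅) :
    cylinder T (r + 1) = cylinder T r \ {S | (S.level (r + 1)).Nonempty} := by
  ext S
  refine ⟨fun hS => ⟨T.cylinder_anti r.le_succ hS, ?_⟩, fun ⟨hS, hlevel⟩ => ?_⟩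
  · exact Set.not_nonempty_iff_eq_empty.2 ((level_eq_of_mem_cylinder hS).trans h)
  · refine rootBall_eq_iff.2 fun v hv => ?_
    obtain hv | hv := hv.lt_or_eq
    · exact mem_verts_iff_of_mem_cylinder hS (Nat.le_of_lt_succ hv)
    · exact iff_of_false (fun hvS => hlevel ⟨v, hvS, hv⟩)
        fun hvT => h.le ⟨hvT, hv⟩

theorem measurableSet_generateFrom_cylinder (T : PlaneTree) (s : ℕ) :
    MeasurableSet[.generateFrom tallCylinders] (cylinder T (s + 1)) := by
  induction s with
  | zero => exact .basic _ ⟨T, 0, ⟨[0], T.singleton_zero_mem, rfl⟩, rfl⟩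
  | succ s ih =>
    obtain h | h := (T.level (s + 2)).eq_empty_or_nonempty
    · rw [cylinder_succ_eq_sdiff h]
      exact ih.diff (measurableSet_generateFrom_setOf_nonempty_level (s + 1))
    · exact .basic _ ⟨T, s + 1, h, rfl⟩

theorem borel_eq_generateFrom_tallCylinders :
    borel PlaneTree = MeasurableSpace.generateFrom tallCylinders := by
  have := isTopologicalBasis_cylinder.secondCountableTopology countable_setOf_eq_cylinder
  rw [isTopologicalBasis_cylinder.borel_eq_generateFrom]
  refine le_antisymm (MeasurableSpace.generateFrom_le ?_) (MeasurableSpace.generateFrom_mono ?_)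
  · rintro _ ⟨T, s, rfl⟩
    exact measurableSet_generateFrom_cylinder T s
  · rintro _ ⟨T, s, -, rfl⟩
    exact ⟨T, s, rfl⟩

theorem ext_of_real_cylinder {ν ν' : ProbabilityMeasure PlaneTree}
    (h : ∀ (T : PlaneTree) (s : ℕ), T.height = (s + 1 : ℕ) →
      (ν : Measure PlaneTree).real (cylinder T (s + 1)) =
        (ν' : Measure PlaneTree).real (cylinder T (s + 1))) : ν = ν' := by
  have hmeas : (ν : Measure PlaneTree) = ν' := by
    refine ext_of_generate_finite tallCylinders borel_eq_generateFrom_tallCylinders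
      isPiSystem_tallCylinders ?_ (by simp)
    rintro _ ⟨T, s, hT, rfl⟩
    rw [← cylinder_trunc]
    exact (measureReal_eq_measureReal_iff).1 (h _ s (height_trunc_eq hT))
  exact Subtype.ext hmeas

section finiteSizeMeasure

open PowerSeries
open scoped PowerSeries.WithPiTopology

variable {μ : ℝ}

/-! ### Weak convergence -/

theorem coeff_heightSeries (m N : ℕ) : coeff N (heightSeries m) = countTrees m N := by
  classical
  have hset : {T : PlaneTree | T.height ≤ m ∧ T.size = N} =
      {T ∈ treesOfSize N | T.height ≤ (m : ℕ∞)} := by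
    ext T
    simp [and_comm]
  rw [countTrees, hset, Set.ncard_coe_finset, Finset.card_filter, Nat.cast_sum, heightSeries,
    coeff_weightedSeries]
  exact Finset.sum_congr rfl fun T _ => by simp [Set.indicator_apply]

theorem partitionFunction_eq (μ : ℝ) (N : ℕ) :
    partitionFunction μ N = coeff N (forestSeries (Real.exp (-μ)) 1) := by
  have hsum := (WithPiTopology.hasSum_iff_hasSum_coeff ℝ).1
    (hasSum_forestSeries (Real.exp (-μ)) 1) N
  rw [← hsum.tsum_eq]
  refine tsum_congr fun m => ?_
  rw [coeff_C_mul, pow_one, pow_one, map_sub, coeff_heightSeries, coeff_heightSeries,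
    ← Real.exp_nat_mul, Nat.cast_succ, mul_comm (-μ)]

theorem finiteSizeMeasure_real_apply (μ : ℝ) (N : ℕ) {A : Set PlaneTree} (hA : MeasurableSet A) :
    (finiteSizeMeasure μ N).real A =
      coeff N (weightedSeries (A.indicator fun T => Real.exp (-μ) ^ T.height.toNat)) /
        coeff N (forestSeries (Real.exp (-μ)) 1) := by
  have : Fintype {T : PlaneTree // T.size = N} := (finite_setOf_size_eq N).fintype
  have hZ : 0 ≤ coeff N (forestSeries (Real.exp (-μ)) 1) :=
    forestSeries_mem_nonnegCoeffs (Real.exp_pos _).le 1 N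
  rw [Measure.real, finiteSizeMeasure, Measure.sum_apply _ hA, tsum_fintype]
  simp only [Measure.smul_apply, smul_eq_mul]
  rw [ENNReal.toReal_sum fun T _ => ENNReal.mul_ne_top ENNReal.ofReal_ne_top (measure_ne_top _ _),
    coeff_weightedSeries, Finset.sum_div, Finset.sum_subtype _ fun T => mem_treesOfSize]
  refine Finset.sum_congr rfl fun T _ => ?_
  rw [Measure.dirac_apply' _ hA, partitionFunction_eq, mul_comm (-μ), Real.exp_nat_mul]
  by_cases hT : T.1 ∈ A
  · simp only [Set.indicator_of_mem hT, Pi.one_apply, mul_one]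
    exact ENNReal.toReal_ofReal (by positivity)
  · simp only [Set.indicator_of_notMem hT, mul_zero, ENNReal.toReal_zero, zero_div]

theorem isProbabilityMeasure_finiteSizeMeasure (μ : ℝ) (N : ℕ) :
    IsProbabilityMeasure (finiteSizeMeasure μ (N + 1)) := by
  have hone : (finiteSizeMeasure μ (N + 1)).real Set.univ = 1 := by
    rw [finiteSizeMeasure_real_apply μ _ .univ, Set.indicator_univ, weightedSeries_pow_height]
    exact div_self (coeff_forestSeries_one_pos (Real.exp_pos _) N).ne'
  exact ⟨by rwa [← ENNReal.toReal_eq_one_iff]⟩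

theorem one_lt_exp_neg (hμ : μ < 0) : 1 < Real.exp (-μ) := Real.one_lt_exp_iff.2 (neg_pos.2 hμ)

theorem real_cylinder_eq (hμ : μ < 0) (T : PlaneTree) (s N : ℕ) :
    (finiteSizeMeasure μ N).real (cylinder T (s + 1)) =
      coeff N (cylinderSeries (Real.exp (-μ)) T s) * criticalPoint (Real.exp (-μ)) ^ (N + 1) /
        (coeff N (forestSeries (Real.exp (-μ)) 1) * criticalPoint (Real.exp (-μ)) ^ (N + 1)) := by
  have hg : criticalPoint (Real.exp (-μ)) ≠ 0 := (criticalPoint_pos (one_lt_exp_neg hμ)).ne'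
  rw [mul_div_mul_right _ _ (pow_ne_zero _ hg),
    finiteSizeMeasure_real_apply μ N (measurableSet_cylinder T s), cylinderSeries]

theorem tendsto_real_cylinder (hμ : μ < 0) (T : PlaneTree) (s : ℕ) :
    Tendsto (fun N => (finiteSizeMeasure μ (N + 1)).real (cylinder T (s + 1))) atTop
      (𝓝 (limitWeight (Real.exp (-μ)) T s)) := by
  have hk := one_lt_exp_neg hμ
  have hresidue := (forestResidue_pos hk).ne'
  have h := ((hasResidueAt_cylinderSeries hk T s).tendsto_coeff.div
    (hasResidueAt_forestSeries_one hk).tendsto_coeff hresidue).comp (tendsto_add_atTop_nat 1)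
  rw [mul_div_cancel_right₀ _ hresidue] at h
  exact h.congr fun N => (real_cylinder_eq hμ T s (N + 1)).symm

theorem exists_real_cylinder_le (hμ : μ < 0) : ∃ M D : ℝ, ∀ (T : PlaneTree) (s N : ℕ),
    (finiteSizeMeasure μ (N + 1)).real (cylinder T (s + 1)) ≤
      (limitWeight (Real.exp (-μ)) T s * M + Real.exp (-μ) ^ s *
        criticalPoint (Real.exp (-μ)) ^ (T.size.toNat + 1)) * D := by
  have hk := one_lt_exp_neg hμ
  have hg := criticalPoint_pos hk
  have hlim := (hasResidueAt_forestSeries_one hk).tendsto_coeff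
  obtain ⟨M, hM⟩ := hlim.bddAbove_range
  obtain ⟨D, hD⟩ :=
    ((hlim.comp (tendsto_add_atTop_nat 1)).inv₀ (forestResidue_pos hk).ne').bddAbove_range
  rw [mem_upperBounds, Set.forall_mem_range] at hM hD
  refine ⟨M, D, fun T s N => ?_⟩
  have hdenom := mul_pos (coeff_forestSeries_one_pos (zero_lt_one.trans hk) N)
    (pow_pos hg (N + 1 + 1))
  have hM0 := hdenom.le.trans (hM (N + 1))
  have hweight := limitWeight_nonneg hk T s
  rw [real_cylinder_eq hμ, div_eq_mul_inv]
  exact mul_le_mul (coeff_cylinderSeries_le hk hM T s _) (hD N) (inv_nonneg.2 hdenom.le)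
    (by positivity)

/-- The trees of height at most `s + 1`; they index the cylinders of radius `s + 1`. -/
abbrev TruncatedTree (s : ℕ) : Type := {T : PlaneTree // T.trunc s = T}

theorem TruncatedTree.size_ne_top {s : ℕ} (T : TruncatedTree s) : T.1.size ≠ ⊤ :=
  T.2 ▸ T.1.size_trunc_ne_top s

instance (s : ℕ) : Countable (TruncatedTree s) :=
  (countable_setOf_size_ne_top.mono fun T hT => TruncatedTree.size_ne_top ⟨T, hT⟩ :
    {T : PlaneTree | T.trunc s = T}.Countable)

theorem pairwise_disjoint_cylinder (s : ℕ) :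
    Pairwise (Function.onFun Disjoint fun T : TruncatedTree s => cylinder T.1 (s + 1)) := by
  refine fun T T' hne => Set.disjoint_left.2 fun S hS hS' => hne (Subtype.ext ?_)
  rw [← T.2, ← T'.2, ← trunc_eq_trunc_iff.2 hS, trunc_eq_trunc_iff.2 hS']

theorem summable_limitWeight (hμ : μ < 0) (s : ℕ) :
    Summable fun T : TruncatedTree s => limitWeight (Real.exp (-μ)) T.1 s := by
  refine summable_of_sum_le (c := 1) (fun T => limitWeight_nonneg (one_lt_exp_neg hμ) T.1 s)
    fun F => le_of_tendsto (tendsto_finsetSum F fun T _ => tendsto_real_cylinder hμ T.1 s)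
      (Eventually.of_forall fun N => ?_)
  have := isProbabilityMeasure_finiteSizeMeasure μ N
  rw [← measureReal_biUnion_finset (fun T _ T' _ hne => pairwise_disjoint_cylinder s hne)
    fun T _ => measurableSet_cylinder T.1 s]
  exact measureReal_le_one

theorem hasSum_pow_size {k : ℝ} (hk : 1 < k) :
    HasSum (fun T : {T : PlaneTree // T.size ≠ ⊤} => criticalPoint k ^ T.1.size.toNat)
      (1 + k)⁻¹ := by
  simpa only [Pi.one_apply, one_mul] using
    hasSum_mul_pow_size zero_le_one (criticalPoint_pos hk).le (hasValueAt_treeSeries hk)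

theorem exists_summable_real_cylinder_le (hμ : μ < 0) (s : ℕ) :
    ∃ β : TruncatedTree s → ℝ, Summable β ∧
      ∀ T N, (finiteSizeMeasure μ (N + 1)).real (cylinder T.1 (s + 1)) ≤ β T := by
  obtain ⟨M, D, hMD⟩ := exists_real_cylinder_le hμ
  have hinj : Function.Injective fun T : TruncatedTree s =>
      (⟨T.1, T.size_ne_top⟩ : {T : PlaneTree // T.size ≠ ⊤}) :=
    fun T T' h => Subtype.ext (Subtype.mk.inj h)
  have hsize : Summable fun T : TruncatedTree s =>
      criticalPoint (Real.exp (-μ)) ^ (T.1.size.toNat + 1) := by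
    simpa only [pow_succ, Function.comp_def] using
      ((hasSum_pow_size (one_lt_exp_neg hμ)).summable.comp_injective hinj).mul_right _
  exact ⟨_, (((summable_limitWeight hμ s).mul_right M).add (hsize.mul_left _)).mul_right D,
    fun T N => hMD T.1 s N⟩

theorem exists_finite_trunc_notMem_le (hμ : μ < 0) (s : ℕ) {ε : ENNReal} (hε : 0 < ε) :
    ∃ F : Set PlaneTree, F.Finite ∧ ∀ N, finiteSizeMeasure μ (N + 1) {T | T.trunc s ∉ F} ≤ ε := by
  obtain ⟨β, hβ, hle⟩ := exists_summable_real_cylinder_le hμ s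
  have hβ0 (T : TruncatedTree s) : 0 ≤ β T := measureReal_nonneg.trans (hle T 0)
  have hsum : ∑' T, ENNReal.ofReal (β T) ≠ ⊤ := by
    rw [← ENNReal.ofReal_tsum_of_nonneg hβ0 hβ]
    exact ENNReal.ofReal_ne_top
  obtain ⟨F, hF⟩ := ((ENNReal.tendsto_tsum_compl_atTop_zero hsum).eventually
    (gt_mem_nhds hε)).exists
  refine ⟨Subtype.val '' (F : Set (TruncatedTree s)), F.finite_toSet.image _, fun N => ?_⟩
  have := isProbabilityMeasure_finiteSizeMeasure μ N
  calc finiteSizeMeasure μ (N + 1) {T | T.trunc s ∉ Subtype.val '' (F : Set (TruncatedTree s))}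
      ≤ finiteSizeMeasure μ (N + 1) (⋃ T : {T // T ∉ F}, cylinder T.1.1 (s + 1)) :=
        measure_mono fun T hT => Set.mem_iUnion.2
          ⟨⟨⟨T.trunc s, T.trunc_trunc s⟩, fun hTF => hT ⟨_, hTF, rfl⟩⟩,
            T.cylinder_trunc s ▸ mem_cylinder_self T _⟩
    _ ≤ ∑' T : {T // T ∉ F}, finiteSizeMeasure μ (N + 1) (cylinder T.1.1 (s + 1)) :=
        measure_iUnion_le _
    _ ≤ ∑' T : {T // T ∉ F}, ENNReal.ofReal (β T.1) := ENNReal.tsum_le_tsum fun T => by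
        rw [← ofReal_measureReal (measure_ne_top _ _)]
        exact ENNReal.ofReal_le_ofReal (hle T.1 N)
    _ ≤ ε := hF.le

/-- The law of a random tree of size `N + 1` as a point of the space of probability measures. -/
noncomputable def finiteSizeLaw (μ : ℝ) (N : ℕ) : ProbabilityMeasure PlaneTree :=
  ⟨finiteSizeMeasure μ (N + 1), isProbabilityMeasure_finiteSizeMeasure μ N⟩

theorem isCompact_closure_range_finiteSizeLaw (hμ : μ < 0) :
    IsCompact (closure (Set.range (finiteSizeLaw μ))) := by
  refine isCompact_closure_of_isTightMeasureSet
    (isTightMeasureSet_iff_exists_isCompact_measure_compl_le.2 fun ε hε => ?_)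
  obtain ⟨δ, hδ0, hδ⟩ := ENNReal.exists_pos_sum_of_countable' hε.ne' ℕ
  choose F hF hFN using fun s => exists_finite_trunc_notMem_le hμ s (hδ0 s)
  refine ⟨_, isCompact_setOf_trunc_mem hF, ?_⟩
  rintro _ ⟨_, ⟨N, rfl⟩, rfl⟩
  have hcompl : {T : PlaneTree | ∀ s, T.trunc s ∈ F s}ᶜ = ⋃ s, {T | T.trunc s ∉ F s} := by
    ext T
    simp
  rw [hcompl]
  exact (measure_iUnion_le _).trans ((ENNReal.tsum_le_tsum fun s => hFN s N).trans hδ.le)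

theorem real_cylinder_of_mapClusterPt (hμ : μ < 0) {ν : ProbabilityMeasure PlaneTree}
    (hν : MapClusterPt ν atTop (finiteSizeLaw μ)) (T : PlaneTree) (s : ℕ) :
    (ν : Measure PlaneTree).real (cylinder T (s + 1)) = limitWeight (Real.exp (-μ)) T s := by
  obtain ⟨U, hU, hUν⟩ := mapClusterPt_iff_ultrafilter.1 hν
  have hmeasure := ProbabilityMeasure.tendsto_measure_of_null_frontier_of_tendsto' hUν
    (E := cylinder T (s + 1)) (by rw [(isClopen_cylinder T s).frontier_eq, measure_empty])
  have hreal := (ENNReal.tendsto_toReal (measure_ne_top _ _)).comp hmeasure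
  exact tendsto_nhds_unique hreal ((tendsto_real_cylinder hμ T s).mono_left hU)

theorem exists_tendsto_finiteSizeLaw (hμ : μ < 0) : ∃ ν, Tendsto (finiteSizeLaw μ) atTop (𝓝 ν) ∧
    ∀ (T : PlaneTree) (s : ℕ),
      (ν : Measure PlaneTree).real (cylinder T (s + 1)) = limitWeight (Real.exp (-μ)) T s := by
  have hcompact := isCompact_closure_range_finiteSizeLaw hμ
  have hmem : ∀ᶠ N in atTop, finiteSizeLaw μ N ∈ closure (Set.range (finiteSizeLaw μ)) :=
    Eventually.of_forall fun N => subset_closure ⟨N, rfl⟩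
  obtain ⟨ν, -, hν⟩ := hcompact.exists_mapClusterPt (le_principal_iff.2 hmem)
  have hcylinder := real_cylinder_of_mapClusterPt hμ hν
  refine ⟨ν, hcompact.tendsto_nhds_of_unique_mapClusterPt hmem fun ν' _ hν' => ?_, hcylinder⟩
  exact ext_of_real_cylinder fun T s _ =>
    (real_cylinder_of_mapClusterPt hμ hν' T s).trans (hcylinder T s).symm

theorem limitWeight_eq {k : ℝ} (hk : 1 < k) {T₀ : PlaneTree} {n s K : ℕ} (hn : T₀.size = n)
    (hs : T₀.height = (s + 1 : ℕ)) (hK : (T₀.level (s + 1)).encard = K) :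
    limitWeight k T₀ s =
      K * k ^ s * criticalPoint k ^ (n - K) * genFun (criticalPoint k) ^ (K - 1) := by
  have hcard : Fintype.card (T₀.level (s + 1)) = K := by
    exact_mod_cast (Set.coe_fintypeCard _).trans hK
  have hcore : (n : ℕ∞) = T₀.coreSize s + K := by rw [← hn, size_eq_coreSize_add hs.le, hK]
  norm_cast at hcore
  rw [limitWeight, hcard, genFun, (hasSum_pow_size hk).tsum_eq, hcore, Nat.add_sub_cancel]
  ring

theorem real_closedBall_iff {k : ℝ} (hk : 1 < k) (ν : ProbabilityMeasure PlaneTree) :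
    (∀ (T₀ : PlaneTree) (n r K : ℕ), T₀.size = n → T₀.height = r → (T₀.level r).encard = K →
      (ν : Measure PlaneTree).real (Metric.closedBall T₀ (1 / (r : ℝ))) =
        K * k ^ (r - 1) * criticalPoint k ^ (n - K) * genFun (criticalPoint k) ^ (K - 1)) ↔
    ∀ (T : PlaneTree) (s : ℕ), T.height = (s + 1 : ℕ) →
      (ν : Measure PlaneTree).real (cylinder T (s + 1)) = limitWeight k T s := by
  constructor
  · intro hball T s hs
    have hfinite : T.size ≠ ⊤ := size_ne_top_iff.2 <|
      (T.finite_rootBall (s + 1)).subset fun v hv => ⟨hv, height_le_iff.1 hs.le v hv⟩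
    have hn := (ENat.natCast_toNat hfinite).symm
    have hK := (Set.coe_fintypeCard (T.level (s + 1))).symm
    rw [limitWeight_eq hk hn hs hK, ← closedBall_eq_cylinder T (Nat.le_add_left 1 s)]
    exact hball T _ _ _ hn hs hK
  · intro hcylinder T n r K hn hr hK
    have hr1 : 1 ≤ r := by exact_mod_cast T.one_le_height.trans hr.le
    obtain ⟨s, rfl⟩ := Nat.exists_eq_add_of_le' hr1
    rw [closedBall_eq_cylinder T hr1, hcylinder T s hr, limitWeight_eq hk hn hr hK,
      Nat.add_sub_cancel]

end finiteSizeMeasure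

end PlaneTree

theorem mainTheorem2 (μ : ℝ) (hμ : μ < 0) (k g : ℝ) (hk : k = Real.exp (-μ))
    (hg : g = PlaneTree.criticalPoint k) :
    -- the series defining `X(g_c(k))` converges
    Summable (fun T : {T : PlaneTree // T.size ≠ ⊤} => g ^ T.1.size.toNat) ∧
    -- each `ν_N`, `N ≥ 1`, is a probability measure
    ∃ hprob : ∀ N : ℕ, IsProbabilityMeasure (PlaneTree.finiteSizeMeasure μ (N + 1)),
    ∃ ν : ProbabilityMeasure PlaneTree,
      -- weak convergence of `(ν_N)_{N ≥ 1}` to `ν`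
      Tendsto (β := ProbabilityMeasure PlaneTree)
        (fun N : ℕ => ⟨PlaneTree.finiteSizeMeasure μ (N + 1), hprob N⟩)
        atTop (𝓝 ν) ∧
      -- `ν` satisfies the ball formula
      (∀ (T₀ : PlaneTree) (n r K : ℕ), T₀.size = n → T₀.height = r → (T₀.level r).encard = K →
        (ν : Measure PlaneTree).real (Metric.closedBall T₀ (1 / (r : ℝ))) =
          K * k ^ (r - 1) * g ^ (n - K) * PlaneTree.genFun g ^ (K - 1)) ∧
      -- and is the only probability measure that does so
      ∀ ν' : ProbabilityMeasure PlaneTree,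
        (∀ (T₀ : PlaneTree) (n r K : ℕ), T₀.size = n → T₀.height = r →
          (T₀.level r).encard = K →
          (ν' : Measure PlaneTree).real (Metric.closedBall T₀ (1 / (r : ℝ))) =
            K * k ^ (r - 1) * g ^ (n - K) * PlaneTree.genFun g ^ (K - 1)) →
        ν' = ν := by
  subst hk hg
  have hk := PlaneTree.one_lt_exp_neg hμ
  obtain ⟨ν, hlim, hν⟩ := PlaneTree.exists_tendsto_finiteSizeLaw hμ
  refine ⟨(PlaneTree.hasSum_pow_size hk).summable,
    PlaneTree.isProbabilityMeasure_finiteSizeMeasure μ, ν, hlim,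
    (PlaneTree.real_closedBall_iff hk ν).2 fun T s _ => hν T s, fun ν' hν' => ?_⟩
  exact PlaneTree.ext_of_real_cylinder fun T s hs =>
    ((PlaneTree.real_closedBall_iff hk ν').1 hν' T s hs).trans (hν T s).symm
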